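/- For $n\ge 1$ let $\mathcal M_n$ be the set of $n\times n$ upper triangular matrices over $\mathbb F_2$ with ones on the diagonal. The matrix walk $(M(t))_{t\ge 0}$ on $\mathcal M_n$ is the continuous time Markov chain in which each row $x\in\{1,\dots,n-1\}$, at the rings of an independent rate one Poisson clock, is replaced by its sum (mod $2$) with $\xi$ times row $x+1$, where $\xi$ is a fresh independent fair bit. For $k\ge 1$ and $1\le i_1<\dots<i_k\le n$ let $\mathcal M_{[i_1,\dots,i_k]}$ be the set of $n\times k$ matrices $A$ over $\mathbb F_2$ whose $j$-th column vanishes in the rows $r>i_j$ and has entry $1$ in row $i_j$ (equivalently, $A$ consists of the columns $i_1,\dots,i_k$ of a matrix in $\mathcal M_n$), and let $\pi$ be the uniform measure on it. For $g:\mathcal M_{[i_1,\dots,i_k]}\to[-1,1]$ we write $g(M)$ for the value of $g$ at the columns $i_1,\dots,i_k$ of $M\in\mathcal M_n$. For $b\ge 0$ let $g_{[1,b]}$ be the $\pi$-average of $g$ over the entries of the last chosen column (column $i_k$) in the rows $1,\dots,b$, all other entries being kept fixed. A row $x$ is called good for the time interval $[t_1,t_2]$ if $$\int_{t_1}^{t_2}\mathbf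 1\Bigl(\bigl(M_{x,i_1}(s),\dots,M_{x,i_k}(s)\bigr)=(0,\dots,0,1)\Bigr)\,ds\ \ge\ \frac{t_2-t_1}{2^{k+1}} .$$ There exist a universal constant $c>0$ and constants $\kappa(k)>0$, $k\ge 1$, depending only on $k$ and satisfying $\kappa(k)\le K2^k$ for a universal constant $K$, such that the following holds for all $k$, $n$ and $1\le i_1<\dots<i_k\le n$ as above, all integers $a\ge 0$ and $\Delta\ge 1$ with $a\le n-2\Delta$, all $t_1>0$ and $t>t_2:=t_1+\kappa(k)\Delta$, all $g:\mathcal M_{[i_1,\dots,i_k]}\to[-1,1]$ that do not depend on the entries of column $i_k$ in the rows $j$ with $1\le j<a$, and all initial conditions $M(0)=M\in\mathcal M_n$. Let $\mathcal B_a$ be the event that some row $x\in[a+\Delta,a+2\Delta]$ is good for $[t_1,t_2]$, and $\mathcal B_a'$ the event that some row $x\in[a+\Delta+1,a+2\Delta]$ is good for $[t_1,t_2]$. Then $$\bigl|\mathbb E\bigl[g(M(t))-g_{[1,a+\Delta]}(M(t))\bigr]\bigr|\le 2\bigl[e^{-c\Delta}+\mathbb P((\mathcal B_a')^c)\bigr]$$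 and $$\bigl|\mathbb E\bigl[g(M(t))-g_{[1,a+\Delta-1]}(M(t))\bigr]\bigr|\le 2\bigl[e^{-c\Delta}+\mathbb P(\mathcal B_a^c)\bigr].$$ -/

import Mathlib

open MeasureTheory ProbabilityTheory

noncomputable section

namespace MatrixWalk

/-! Rows and columns of an `n × n` matrix are indexed by `Fin n`; the row (or column) with index
`x : Fin n` is the row number `x + 1` in the usual numbering `1, …, n`. -/

/-- The matrices over `𝔽₂` with `n` rows whose `k` columns are columns number `i 0, …, i (k - 1)`
of some uni-upper triangular matrix: the column `j` vanishes strictly below row `i j`, and its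
entry in row `i j` is `1`. -/
def ColMat (n : ℕ) {k : ℕ} (i : Fin k → Fin n) : Type :=
  {A : Matrix (Fin n) (Fin k) (ZMod 2) // ∀ j, (∀ r, i j < r → A r j = 0) ∧ A (i j) j = 1}

/-- The `n × n` upper triangular matrices over `𝔽₂` with ones on the diagonal. -/
abbrev UniMat (n : ℕ) : Type := ColMat n (id : Fin n → Fin n)

/-- The chosen columns `i 0, …, i (k - 1)` of a uni-upper triangular matrix. -/
def cols {n k : ℕ} (i : Fin k → Fin n) (M : UniMat n) : ColMat n i :=
  ⟨fun r j => M.1 r (i j), fun j => ⟨fun r hr => (M.2 (i j)).1 r hr, (M.2 (i j)).2⟩⟩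

instance {n k : ℕ} (i : Fin k → Fin n) : Finite (ColMat n i) :=
  inferInstanceAs (Finite {A : Matrix (Fin n) (Fin k) (ZMod 2) //
    ∀ j, (∀ r, i j < r → A r j = 0) ∧ A (i j) j = 1})

instance {n k : ℕ} (i : Fin k → Fin n) : Fintype (ColMat n i) := Fintype.ofFinite _

/-! ### The noise and the walk (graphical construction) -/

/-- A noise configuration: for each row `x` and each `j`, the waiting time between the ring number
`j` and the ring number `j + 1` of the clock of row `x` (the first ring has number `1`), and the bit
used at the latter ring. The clock of the last row is never used. -/
abbrev Noise (n : ℕ) : Type := Fin n × ℕ → ℝ × ZMod 2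

/-- The law of one waiting time and one bit: an exponential variable of rate one, and an
independent fair bit. -/
def stepLaw : Measure (ℝ × ZMod 2) :=
  (expMeasure 1).prod (PMF.uniformOfFintype (ZMod 2)).toMeasure

instance : IsProbabilityMeasure stepLaw := by
  have : IsProbabilityMeasure (expMeasure 1) := isProbabilityMeasure_expMeasure one_pos
  unfold stepLaw
  infer_instance

/-- The law of the noise: all the waiting times and bits are independent. Thus the rings of the
different rows are independent rate one Poisson processes, independent of the fair bits. -/
def noiseLaw (n : ℕ) : Measure (Noise n) := Measure.infinitePi fun _ => stepLaw

/-- The time of the ring of index `j = 0, 1, 2, …` of the clock of row `x`. -/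
def ring {n : ℕ} (ω : Noise n) (x : Fin n) (j : ℕ) : ℝ :=
  ∑ l ∈ Finset.range (j + 1), (ω (x, l)).1

/-- The row `x` at time `t` of the walk with initial matrix `M`. At each ring of the clock of row
`x` the row below, multiplied by the bit of that ring, is added to row `x`; the last row never
changes. Almost surely no two rings occur at the same time, so that the row below has the same
value at a ring of row `x` and just before it; and only finitely many rings occur up to time `t`,
so that the sum is a finite one. -/
def walkRow {n : ℕ} (M : Matrix (Fin n) (Fin n) (ZMod 2)) (ω : Noise n) (x : Fin n) (t : ℝ) :
    Fin n → ZMod 2 :=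
  if h : x.val + 1 < n then
    M x + ∑ᶠ (j : ℕ) (_ : ring ω x j ≤ t),
      (ω (x, j)).2 • walkRow M ω ⟨x.val + 1, h⟩ (ring ω x j)
  else M x
termination_by n - x.val

/-- The walk stays in the set of uni-upper triangular matrices. -/
theorem walkRow_mem {n : ℕ} (M : UniMat n) (ω : Noise n) (x : Fin n) (t : ℝ) :
    (∀ y, y < x → walkRow M.1 ω x t y = 0) ∧ walkRow M.1 ω x t x = 1 := by
  induction h : n - x.val using Nat.strong_induction_on generalizing x t with
  | _ m ih =>
    have hM : (∀ y, y < x → M.1 x y = 0) ∧ M.1 x x = 1 :=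
      ⟨fun y hy => (M.2 y).1 x hy, (M.2 x).2⟩
    rw [walkRow]
    split_ifs with hx
    · have key : ∀ y, y ≤ x → (∑ᶠ (j : ℕ) (_ : ring ω x j ≤ t),
          (ω (x, j)).2 • walkRow M.1 ω ⟨x.val + 1, hx⟩ (ring ω x j)) y = 0 := by
        intro y hy
        refine finsum_mem_induction (p := fun v : Fin n → ZMod 2 => v y = 0) rfl
          (fun a b ha hb => by simp only [Pi.add_apply, ha, hb, add_zero]) ?_
        intro j _
        have := (ih (n - (x.val + 1)) (by omega) ⟨x.val + 1, hx⟩ (ring ω x j) rfl).1 y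
          (Fin.lt_def.2 (Nat.lt_succ_of_le hy))
        simp only [Pi.smul_apply, this, smul_zero]
      refine ⟨fun y hy => ?_, ?_⟩
      · rw [Pi.add_apply, key y hy.le, hM.1 y hy, add_zero]
      · rw [Pi.add_apply, key x le_rfl, hM.2, add_zero]
    · exact hM

/-- The matrix walk at time `t`, with initial matrix `M`. -/
def walk {n : ℕ} (M : UniMat n) (ω : Noise n) (t : ℝ) : UniMat n :=
  ⟨fun x => walkRow M.1 ω x t,
    fun j => ⟨fun r hr => (walkRow_mem M ω r t).1 j hr, (walkRow_mem M ω j t).2⟩⟩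

/-! ### Averages and good rows -/

/-- Two elements of `ColMat n i` agree at all entries outside the set `S` of entries. -/
def AgreeOff {n k : ℕ} {i : Fin k → Fin n} (S : Set (Fin n × Fin k)) (A B : ColMat n i) : Prop :=
  ∀ r j, (r, j) ∉ S → A.1 r j = B.1 r j

open Classical in
/-- The average of `g` over the entries in `S` with respect to the uniform measure on `ColMat n i`,
the other entries being those of `A`. -/
def avg {n k : ℕ} {i : Fin k → Fin n} (S : Set (Fin n × Fin k)) (g : ColMat n i → ℝ)
    (A : ColMat n i) : ℝ :=
  (∑ B with AgreeOff S A B, g B) / (Finset.univ.filter fun B => AgreeOff S A B).card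

/-- The entries of the last of the `k` chosen columns in the rows number `1, …, b`. -/
def lastColUpTo (n k b : ℕ) : Set (Fin n × Fin k) :=
  {p | p.1.val + 1 ≤ b ∧ p.2.val + 1 = k}

/-- Row `r` of `A` is `(0, …, 0, 1)`. -/
def Pattern {n k : ℕ} {i : Fin k → Fin n} (A : ColMat n i) (r : Fin n) : Prop :=
  ∀ j : Fin k, A.1 r j = if j.val + 1 = k then 1 else 0

open Classical in
/-- Row `r` is good for `[s, t]` along a trajectory: it shows the pattern `(0, …, 0, 1)` for a
fraction at least `1 / 2 ^ (k + 1)` of that time interval. -/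
def GoodRow {n k : ℕ} {i : Fin k → Fin n} (A : ℝ → ColMat n i) (s t : ℝ) (r : Fin n) : Prop :=
  (t - s) / 2 ^ (k + 1) ≤ ∫ u in s..t, (if Pattern (A u) r then (1 : ℝ) else 0)

/-- The event that some row with number in `[p, q]` is good for `[s, t]`. -/
def goodEvent {n k : ℕ} (i : Fin k → Fin n) (M : UniMat n) (p q : ℕ) (s t : ℝ) : Set (Noise n) :=
  {ω | ∃ r : Fin n, p ≤ r.val + 1 ∧ r.val + 1 ≤ q ∧ GoodRow (fun u => cols i (walk M ω u)) s t r}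

end MatrixWalk

end

/-! Here the rows "below `x`" are those of smaller index. Row `y` is driven by row `y + 1`, so the
noise of the rows from `x` on determines the trajectory of row `x`. Freeze that noise for a good row
`x` and average over the noise of the rows below `x`. Let p = (0, …, 0, 1) and G = g - avg g, and
expand G in Walsh characters along the multiples of p in the rows below `x`, with index sets u of
such rows.

Adding row y + 1 to row y acts on u by duality: y + 1 is toggled exactly when y ∈ u
(`walshCoeff_rowOp`). With fair bits the coefficients therefore follow an East process. The update
of row x - 1 by row x commutes with shifts by p and leaves u alone; but while row x equals p, the
fair bit cancels every coefficient with x - 1 ∈ u (`walshCoeff_rowOp_self`). The coefficients still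
depend on the other entries, so only suprema over these are followed (`abs_walshCoeff_cellOp_le`).
The coefficient of ∅ vanishes because the average was removed, and no u contains a row on which g
does not depend. The dynamics preserves both facts, since a flip never changes the least element of
u.

The killed East process has a spectral gap independent of the number of sites (`east_spectral`), so
the ℓ² norm of the suprema decays exponentially in the time during which row x equals p, which is at
least (t₂ - t₁) / 2 ^ (k + 1) for a good row. Passing between the sup norm and ℓ² costs at most 4 ^
Δ, one factor 2 for each of the at most 2Δ relevant rows, and a large κ absorbs this.

To avoid generators in continuous time, [0, t] is cut into N cells. Up to an error vanishing as N →
∞, each cell contains at most one ring of a row below x, and none if row x itself rings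
(`abs_integral_mergeNoise_le_gridOp`); the estimate for fixed frozen noise follows in the limit
(`abs_integral_mergeNoise_le`).

Finally, the good event is split according to the good row of largest index in the window. That
event depends only on the noise from this row on, so Fubini applies (`abs_setIntegral_lastGood_le`).
Off the good event, |G| ≤ 2 is used. -/

namespace MatrixWalk

/-! ### A spectral inequality for the East model

Configurations are finite sets of sites. The configurations of the block started at `y₀` contain
the site `y₀`; the site `y + 1` may be toggled as soon as the site `y` is present. -/

/-- The average over the configurations of the block `{y₀, …, y₀ + m}` which contain `y₀`. -/
noncomputable def eastAv (y₀ : ℕ) : ℕ → (Finset ℕ → ℝ) → ℝ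
  | 0, f => f {y₀}
  | m + 1, f => (eastAv y₀ m f + eastAv y₀ m (fun u => f (insert (y₀ + m + 1) u))) / 2

/-- The Dirichlet form of the East model on the block `{y₀, …, y₀ + m}`, the site `y₀ + m - i`
having the weight `w i`. -/
noncomputable def eastDir (y₀ : ℕ) : ℕ → (ℕ → ℝ) → (Finset ℕ → ℝ) → ℝ
  | 0, _, _ => 0
  | m + 1, w, f =>
    w 0 * eastAv y₀ m (fun u => if y₀ + m ∈ u then (f (insert (y₀ + m + 1) u) - f u) ^ 2 else 0)
      + (eastDir y₀ m (fun i => w (i + 1)) f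
        + eastDir y₀ m (fun i => w (i + 1)) (fun u => f (insert (y₀ + m + 1) u))) / 2

theorem eastAv_mono {y₀ m : ℕ} {f g : Finset ℕ → ℝ}
    (h : ∀ u ⊆ Finset.Icc y₀ (y₀ + m), f u ≤ g u) : eastAv y₀ m f ≤ eastAv y₀ m g := by
  induction m generalizing f g with
  | zero => exact h _ (by simp)
  | succ m ih =>
    have h1 : eastAv y₀ m f ≤ eastAv y₀ m g :=
      ih fun u hu => h u (hu.trans (Finset.Icc_subset_Icc_right (by omega)))
    have h2 : eastAv y₀ m (fun u => f (insert (y₀ + m + 1) u))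
        ≤ eastAv y₀ m (fun u => g (insert (y₀ + m + 1) u)) :=
      ih fun u hu => h _ (Finset.insert_subset (by simp; omega)
        (hu.trans (Finset.Icc_subset_Icc_right (by omega))))
    simp only [eastAv]
    linarith

theorem eastAv_congr {y₀ m : ℕ} {f g : Finset ℕ → ℝ}
    (h : ∀ u ⊆ Finset.Icc y₀ (y₀ + m), f u = g u) : eastAv y₀ m f = eastAv y₀ m g :=
  le_antisymm (eastAv_mono fun u hu => (h u hu).le) (eastAv_mono fun u hu => (h u hu).ge)

theorem eastAv_add (y₀ m : ℕ) (f g : Finset ℕ → ℝ) :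
    eastAv y₀ m (fun u => f u + g u) = eastAv y₀ m f + eastAv y₀ m g := by
  induction m generalizing f g with
  | zero => rfl
  | succ m ih => simp only [eastAv, ih]; ring

theorem eastAv_mul (y₀ m : ℕ) (c : ℝ) (f : Finset ℕ → ℝ) :
    eastAv y₀ m (fun u => c * f u) = c * eastAv y₀ m f := by
  induction m generalizing f with
  | zero => rfl
  | succ m ih => simp only [eastAv, ih]; ring

theorem eastAv_sub (y₀ m : ℕ) (f g : Finset ℕ → ℝ) :
    eastAv y₀ m (fun u => f u - g u) = eastAv y₀ m f - eastAv y₀ m g := by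
  induction m generalizing f g with
  | zero => rfl
  | succ m ih => simp only [eastAv, ih]; ring

theorem eastAv_nonneg {y₀ m : ℕ} {f : Finset ℕ → ℝ} (h : ∀ u, 0 ≤ f u) : 0 ≤ eastAv y₀ m f := by
  induction m generalizing f with
  | zero => exact h _
  | succ m ih =>
    have h1 := ih h
    have h2 := ih (f := fun u => f (insert (y₀ + m + 1) u)) fun u => h _
    simp only [eastAv]
    linarith

theorem sq_eastAv_le (y₀ m : ℕ) (f : Finset ℕ → ℝ) :
    eastAv y₀ m f ^ 2 ≤ eastAv y₀ m (fun u => f u ^ 2) := by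
  induction m generalizing f with
  | zero => exact le_rfl
  | succ m ih =>
    have h1 := ih f
    have h2 := ih fun u => f (insert (y₀ + m + 1) u)
    simp only [eastAv]
    nlinarith [sq_nonneg (eastAv y₀ m f - eastAv y₀ m fun u => f (insert (y₀ + m + 1) u))]

theorem eastDir_mono {y₀ m : ℕ} {w v : ℕ → ℝ} (h : ∀ i, w i ≤ v i) (f : Finset ℕ → ℝ) :
    eastDir y₀ m w f ≤ eastDir y₀ m v f := by
  induction m generalizing w v f with
  | zero => exact le_rfl
  | succ m ih =>
    have h1 := ih (fun i => h (i + 1)) f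
    have h2 := ih (fun i => h (i + 1)) fun u => f (insert (y₀ + m + 1) u)
    have h3 := mul_le_mul_of_nonneg_right (h 0) (eastAv_nonneg (y₀ := y₀) (m := m)
      (f := fun u => if y₀ + m ∈ u then (f (insert (y₀ + m + 1) u) - f u) ^ 2 else 0)
      fun u => by positivity)
    simp only [eastDir]
    linarith

theorem eastDir_add (y₀ m : ℕ) (w v : ℕ → ℝ) (f : Finset ℕ → ℝ) :
    eastDir y₀ m (fun i => w i + v i) f = eastDir y₀ m w f + eastDir y₀ m v f := by
  induction m generalizing w v f with
  | zero => simp [eastDir]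
  | succ m ih => simp only [eastDir, ih]; ring

theorem eastDir_mul (y₀ m : ℕ) (c : ℝ) (w : ℕ → ℝ) (f : Finset ℕ → ℝ) :
    eastDir y₀ m (fun i => c * w i) f = c * eastDir y₀ m w f := by
  induction m generalizing w f with
  | zero => simp [eastDir]
  | succ m ih => simp only [eastDir, ih]; ring

theorem eastDir_sub_le {y₀ m : ℕ} {w : ℕ → ℝ} (hw : ∀ i, 0 ≤ w i) (f g : Finset ℕ → ℝ) :
    eastDir y₀ m w (fun u => f u - g u) ≤ 2 * eastDir y₀ m w f + 2 * eastDir y₀ m w g := by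
  induction m generalizing w f g with
  | zero => simp [eastDir]
  | succ m ih =>
    have h1 := ih (fun i => hw (i + 1)) f g
    have h2 := ih (fun i => hw (i + 1)) (fun u => f (insert (y₀ + m + 1) u))
      (fun u => g (insert (y₀ + m + 1) u))
    have h3 : eastAv y₀ m (fun u => if y₀ + m ∈ u then (f (insert (y₀ + m + 1) u)
          - g (insert (y₀ + m + 1) u) - (f u - g u)) ^ 2 else 0)
        ≤ 2 * eastAv y₀ m (fun u => if y₀ + m ∈ u then (f (insert (y₀ + m + 1) u) - f u) ^ 2 else 0)
          + 2 * eastAv y₀ m (fun u =>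
            if y₀ + m ∈ u then (g (insert (y₀ + m + 1) u) - g u) ^ 2 else 0) := by
      rw [← eastAv_mul, ← eastAv_mul, ← eastAv_add]
      refine eastAv_mono fun u _ => ?_
      split_ifs
      · nlinarith [sq_nonneg (f (insert (y₀ + m + 1) u) - f u
          + (g (insert (y₀ + m + 1) u) - g u))]
      · simp
    have h4 := mul_le_mul_of_nonneg_left h3 (hw 0)
    simp only [eastDir]
    linarith

/-- The square of the mean is controlled by the configurations which contain the last site, and by
the Dirichlet form with geometrically decreasing weights. -/
theorem sq_eastAv_le_dir (y₀ m : ℕ) (f : Finset ℕ → ℝ) :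
    eastAv y₀ m f ^ 2 ≤ 12 * eastAv y₀ m (fun u => if y₀ + m ∈ u then f u ^ 2 else 0)
      + eastDir y₀ m (fun i => 24 * (5 / 8) ^ i) f := by
  induction m generalizing f with
  | zero => simp only [eastAv, eastDir]; simp; nlinarith [sq_nonneg (f {y₀})]
  | succ m ih =>
    set f₁ : Finset ℕ → ℝ := fun u => f (insert (y₀ + m + 1) u) with hf₁
    have hlast : eastAv y₀ (m + 1) (fun u => if y₀ + (m + 1) ∈ u then f u ^ 2 else 0)
        = eastAv y₀ m (fun u => f₁ u ^ 2) / 2 := by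
      have h0 : eastAv y₀ m (fun u => if y₀ + (m + 1) ∈ u then f u ^ 2 else 0)
          = eastAv y₀ m (fun _ => 0 * 0) := by
        refine eastAv_congr fun u hu => ?_
        rw [if_neg, mul_zero]
        intro h
        have := Finset.mem_Icc.1 (hu h)
        omega
      rw [eastAv_mul, zero_mul] at h0
      simp only [eastAv, h0, zero_add]
      congr 2
      funext u
      simp [hf₁, ← add_assoc]
    have hw : (fun i : ℕ => (24 : ℝ) * (5 / 8) ^ (i + 1))
        = fun i => 5 / 8 * (24 * (5 / 8) ^ i) := by
      funext i; ring
    have hD1 : 0 ≤ eastDir y₀ m (fun i => 24 * (5 / 8) ^ i) f₁ := by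
      have h1 := eastDir_mono (y₀ := y₀) (m := m) (w := fun i : ℕ => 0 * (24 * (5 / 8 : ℝ) ^ i))
        (v := fun i => 24 * (5 / 8) ^ i) (fun i => by simp; positivity) f₁
      rwa [eastDir_mul, zero_mul] at h1
    have hX := ih f
    have hY := sq_eastAv_le y₀ m f₁
    have hQ0 : 0 ≤ eastAv y₀ m (fun u => if y₀ + m ∈ u then (f₁ u - f u) ^ 2 else 0) :=
      eastAv_nonneg fun u => by positivity
    have hP0 : 0 ≤ eastAv y₀ m (fun u => f₁ u ^ 2) := eastAv_nonneg fun u => by positivity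
    -- When the last old site is present, the new one may be toggled, so f = f₁ - (f₁ - f) compares
    -- f with f₁ through the Dirichlet form: (α - β)² ≤ 5/4 α² + 5 β².
    have hL : eastAv y₀ m (fun u => if y₀ + m ∈ u then f u ^ 2 else 0)
        ≤ 5 * eastAv y₀ m (fun u => if y₀ + m ∈ u then (f₁ u - f u) ^ 2 else 0)
          + 5 / 4 * eastAv y₀ m (fun u => f₁ u ^ 2) := by
      rw [← eastAv_mul, ← eastAv_mul, ← eastAv_add]
      refine eastAv_mono fun u _ => ?_
      split_ifs
      · nlinarith [sq_nonneg (4 * (f₁ u - f u) + f₁ u)]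
      · positivity
    rw [hlast]
    simp only [eastDir, hw]
    rw [eastDir_mul y₀ m (5 / 8), eastDir_mul y₀ m (5 / 8), eastAv]
    change ((eastAv y₀ m f + eastAv y₀ m f₁) / 2) ^ 2 ≤ _
    change _ ≤ _ + (24 * (5 / 8 : ℝ) ^ 0
      * eastAv y₀ m (fun u => if y₀ + m ∈ u then (f₁ u - f u) ^ 2 else 0) + (_
        + 5 / 8 * eastDir y₀ m (fun i => 24 * (5 / 8) ^ i) f₁) / 2)
    -- With X, Y the two means, ((X + Y)/2)² ≤ 5/16 X² + 5/4 Y². The first coefficient is half of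
    -- 5/8, the ratio of the weights. The rest closes because 12 · 5/16 · 5 ≤ 24 and 12 · 5/16 · 5/4
    -- + 5/4 ≤ 12/2.
    nlinarith [sq_nonneg (eastAv y₀ m f - 4 * eastAv y₀ m f₁)]

/-- A Poincaré inequality for the East model. -/
theorem eastAv_variance_le (y₀ m : ℕ) (f : Finset ℕ → ℝ) :
    eastAv y₀ m (fun u => f u ^ 2) - eastAv y₀ m f ^ 2
      ≤ eastDir y₀ m (fun i => 67 - 64 * (5 / 8) ^ i) f := by
  induction m generalizing f with
  | zero => simp [eastAv, eastDir]
  | succ m ih =>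
    set f₁ : Finset ℕ → ℝ := fun u => f (insert (y₀ + m + 1) u) with hf₁
    have h0 := ih f
    have h1 := ih f₁
    have hA := sq_eastAv_le_dir y₀ m fun u => f₁ u - f u
    have hS := eastDir_sub_le (y₀ := y₀) (m := m) (w := fun i => 24 * (5 / 8) ^ i)
      (fun i => by positivity) f₁ f
    rw [eastAv_sub] at hA
    -- The variance gains a quarter of the squared mean of f₁ - f, which costs 3 at the new site and
    -- 24 (5/8)^i elsewhere. The weights 67 - 64 (5/8)^i start at 3 and have exactly these
    -- increments; the geometric sum keeps them bounded.
    have hw : (fun i : ℕ => (67 : ℝ) - 64 * (5 / 8) ^ (i + 1))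
        = fun i => (67 - 64 * (5 / 8) ^ i) + 24 * (5 / 8) ^ i := by
      funext i; ring
    simp only [eastDir, hw, eastDir_add]
    simp only [eastAv]
    change (_ + eastAv y₀ m (fun u => f₁ u ^ 2)) / 2
      - ((eastAv y₀ m f + eastAv y₀ m f₁) / 2) ^ 2 ≤ (67 - 64 * (5 / 8 : ℝ) ^ 0)
      * eastAv y₀ m (fun u => if y₀ + m ∈ u then (f₁ u - f u) ^ 2 else 0) + (_ +
        (eastDir y₀ m (fun i => 67 - 64 * (5 / 8) ^ i) f₁
          + eastDir y₀ m (fun i => 24 * (5 / 8) ^ i) f₁)) / 2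
    rw [pow_zero]
    nlinarith

/-- The second moment is the variance plus the squared mean, and (67 - 64 q) + 24 q ≤ 67 for q =
(5/8)^i ≥ 0. -/
theorem eastAv_sq_le (y₀ m : ℕ) (f : Finset ℕ → ℝ) :
    eastAv y₀ m (fun u => f u ^ 2)
      ≤ 67 * (eastAv y₀ m (fun u => if y₀ + m ∈ u then f u ^ 2 else 0)
        + eastDir y₀ m (fun _ => 1) f) := by
  have h1 := sq_eastAv_le_dir y₀ m f
  have h2 := eastAv_variance_le y₀ m f
  have h3 := eastDir_mono (y₀ := y₀) (m := m)
    (w := fun i => (67 - 64 * (5 / 8) ^ i) + 24 * (5 / 8) ^ i) (v := fun i => 67 * 1)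
    (fun i => by have : (0 : ℝ) ≤ (5 / 8) ^ i := by positivity
                 linarith) f
  have h4 : 0 ≤ eastAv y₀ m (fun u => if y₀ + m ∈ u then f u ^ 2 else 0) :=
    eastAv_nonneg fun u => by positivity
  rw [eastDir_add, eastDir_mul y₀ m 67] at h3
  linarith

/-! ### Unnormalised sums over configurations, and the killed East process -/

/-- Toggle the site `y + 1` if the site `y` is present. -/
def eastFlip (y : ℕ) (u : Finset ℕ) : Finset ℕ := if y ∈ u then symmDiff u {y + 1} else u

theorem two_pow_mul_eastAv (y₀ m : ℕ) (f : Finset ℕ → ℝ) :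
    2 ^ m * eastAv y₀ m f = ∑ u ∈ (Finset.Ioc y₀ (y₀ + m)).powerset, f (insert y₀ u) := by
  induction m generalizing f with
  | zero => simp [eastAv]
  | succ m ih =>
    have h : Finset.Ioc y₀ (y₀ + (m + 1)) = insert (y₀ + m + 1) (Finset.Ioc y₀ (y₀ + m)) := by
      ext; simp; omega
    rw [h, Finset.sum_powerset_insert (by simp)]
    simp only [fun t : Finset ℕ => Finset.insert_comm y₀ (y₀ + m + 1) t]
    rw [← ih f, ← ih fun u => f (insert (y₀ + m + 1) u), eastAv]
    ring

theorem eastFlip_insert {y z : ℕ} (h : y + 1 < z) (u : Finset ℕ) :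
    eastFlip y (insert z u) = insert z (eastFlip y u) := by
  unfold eastFlip
  have h1 : y ≠ z := by omega
  have h2 : z ≠ y + 1 := by omega
  simp only [Finset.mem_insert, h1, false_or]
  split_ifs
  · ext r
    simp only [Finset.mem_symmDiff, Finset.mem_insert, Finset.mem_singleton]
    by_cases hr : r = z
    · subst hr; simp [h2]
    · simp [hr]
  · rfl

theorem eastFlip_eastFlip (y : ℕ) (u : Finset ℕ) : eastFlip y (eastFlip y u) = u := by
  unfold eastFlip
  by_cases h : y ∈ u
  · have h' : y ∈ symmDiff u {y + 1} := by simp [Finset.mem_symmDiff, h]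
    rw [if_pos h, if_pos h', symmDiff_symmDiff_cancel_right]
  · simp [h]

/-- The recursive form sees each toggle of the last site once, while the sum over configurations
sees it from both endpoints; this is the factor 2 between 2 ^ m and 2 ^ (m + 1). -/
theorem two_pow_mul_eastDir (y₀ m : ℕ) (f : Finset ℕ → ℝ) :
    2 ^ m * eastDir y₀ m (fun _ => 1) f = ∑ u ∈ (Finset.Ioc y₀ (y₀ + m)).powerset,
      ∑ y ∈ Finset.Ico y₀ (y₀ + m), (f (eastFlip y (insert y₀ u)) - f (insert y₀ u)) ^ 2 := by
  induction m generalizing f with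
  | zero => simp [eastDir]
  | succ m ih =>
    have h : Finset.Ioc y₀ (y₀ + (m + 1)) = insert (y₀ + m + 1) (Finset.Ioc y₀ (y₀ + m)) := by
      ext; simp; omega
    have h' : Finset.Ico y₀ (y₀ + (m + 1)) = insert (y₀ + m) (Finset.Ico y₀ (y₀ + m)) := by
      ext; simp; omega
    rw [h, Finset.sum_powerset_insert (by simp), h']
    simp only [Finset.sum_insert (s := Finset.Ico y₀ (y₀ + m)) (a := y₀ + m) (by simp),
      Finset.sum_add_distrib, fun t : Finset ℕ => Finset.insert_comm y₀ (y₀ + m + 1) t]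
    have e1 : ∑ u ∈ (Finset.Ioc y₀ (y₀ + m)).powerset, ∑ y ∈ Finset.Ico y₀ (y₀ + m),
        (f (eastFlip y (insert (y₀ + m + 1) (insert y₀ u)))
          - f (insert (y₀ + m + 1) (insert y₀ u))) ^ 2
        = ∑ u ∈ (Finset.Ioc y₀ (y₀ + m)).powerset, ∑ y ∈ Finset.Ico y₀ (y₀ + m),
        (f (insert (y₀ + m + 1) (eastFlip y (insert y₀ u)))
          - f (insert (y₀ + m + 1) (insert y₀ u))) ^ 2 := by
      refine Finset.sum_congr rfl fun u _ => Finset.sum_congr rfl fun y hy => ?_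
      rw [eastFlip_insert (by have := Finset.mem_Ico.1 hy; omega)]
    have hmem : ∀ u ∈ (Finset.Ioc y₀ (y₀ + m)).powerset, y₀ + m + 1 ∉ insert y₀ u := by
      intro u hu hmem
      rw [Finset.mem_insert] at hmem
      rcases hmem with hmem | hmem
      · omega
      · have := Finset.mem_Ioc.1 (Finset.mem_powerset.1 hu hmem)
        omega
    have e2 : ∀ u ∈ (Finset.Ioc y₀ (y₀ + m)).powerset,
        (f (eastFlip (y₀ + m) (insert y₀ u)) - f (insert y₀ u)) ^ 2
        = if y₀ + m ∈ insert y₀ u then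
          (f (insert (y₀ + m + 1) (insert y₀ u)) - f (insert y₀ u)) ^ 2 else 0 := by
      intro u hu
      unfold eastFlip
      split_ifs
      · congr 4
        ext r
        have := hmem u hu
        simp only [Finset.mem_symmDiff, Finset.mem_singleton]
        rw [Finset.mem_insert (b := y₀ + m + 1)]
        by_cases hr : r = y₀ + m + 1
        · rw [hr]; simp only [this]; simp
        · simp [hr]
      · simp
    have e3 : ∀ u ∈ (Finset.Ioc y₀ (y₀ + m)).powerset,
        (f (eastFlip (y₀ + m) (insert (y₀ + m + 1) (insert y₀ u)))
          - f (insert (y₀ + m + 1) (insert y₀ u))) ^ 2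
        = if y₀ + m ∈ insert y₀ u then
          (f (insert (y₀ + m + 1) (insert y₀ u)) - f (insert y₀ u)) ^ 2 else 0 := by
      intro u hu
      unfold eastFlip
      have hne : y₀ + m ≠ y₀ + m + 1 := by omega
      simp only [Finset.mem_insert (b := y₀ + m + 1), hne, false_or]
      split_ifs
      · rw [← neg_sq, neg_sub]
        congr 3
        ext r
        have := hmem u hu
        simp only [Finset.mem_symmDiff, Finset.mem_singleton]
        rw [Finset.mem_insert (b := y₀ + m + 1)]
        by_cases hr : r = y₀ + m + 1
        · rw [hr]; simp only [this]; simp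
        · simp [hr]
      · simp
    rw [e1, Finset.sum_congr rfl e2, Finset.sum_congr rfl e3]
    have i1 := ih f
    have i2 := ih fun u => f (insert (y₀ + m + 1) u)
    have i3 := two_pow_mul_eastAv y₀ m (fun u =>
      if y₀ + m ∈ u then (f (insert (y₀ + m + 1) u) - f u) ^ 2 else 0)
    rw [eastDir, pow_succ]
    linarith

/-- The generator of the East process, killed when the last site `x - 1` is occupied, has a spectral
gap which does not depend on the number of sites. -/
theorem east_spectral (a d : ℕ) (f : Finset ℕ → ℝ) (h0 : f ∅ = 0) :
    ∑ u ∈ (Finset.Ico a (a + d)).powerset, f u ^ 2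
      ≤ 67 * (∑ u ∈ (Finset.Ico a (a + d)).powerset, (if a + d - 1 ∈ u then f u ^ 2 else 0)
        + ∑ u ∈ (Finset.Ico a (a + d)).powerset, ∑ y ∈ Finset.Ico a (a + d - 1),
          (f (eastFlip y u) - f u) ^ 2) := by
  -- Flips preserve the least element. The configurations containing a form one block, treated by
  -- `eastAv_sq_le`; the others start further right. What remains at the end is ∅, a fixed point of
  -- all flips, hence the assumption f ∅ = 0.
  induction d generalizing a with
  | zero => simp [h0]
  | succ d ih =>
    have h : Finset.Ico a (a + (d + 1)) = insert a (Finset.Ico (a + 1) (a + 1 + d)) := by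
      ext; simp; omega
    have hI : Finset.Ico (a + 1) (a + 1 + d) = Finset.Ioc a (a + d) := by ext; simp; omega
    have h1 := ih (a + 1)
    have h2 := mul_le_mul_of_nonneg_left (eastAv_sq_le a d f) (show (0 : ℝ) ≤ 2 ^ d by positivity)
    rw [mul_left_comm, mul_add, two_pow_mul_eastAv, two_pow_mul_eastAv, two_pow_mul_eastDir] at h2
    rw [h, Finset.sum_powerset_insert (by simp), Finset.sum_powerset_insert (by simp),
      Finset.sum_powerset_insert (by simp)]
    have e1 : a + (d + 1) - 1 = a + d := by omega
    have h3 : ∑ u ∈ (Finset.Ico (a + 1) (a + 1 + d)).powerset,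
        ∑ y ∈ Finset.Ico (a + 1) (a + 1 + d - 1), (f (eastFlip y u) - f u) ^ 2
        ≤ ∑ u ∈ (Finset.Ico (a + 1) (a + 1 + d)).powerset,
        ∑ y ∈ Finset.Ico a (a + d), (f (eastFlip y u) - f u) ^ 2 := by
      refine Finset.sum_le_sum fun u _ => Finset.sum_le_sum_of_subset_of_nonneg ?_
        fun _ _ _ => sq_nonneg _
      intro y; simp; omega
    have e2 : a + 1 + d - 1 = a + d := by omega
    rw [e2] at h1
    rw [e2] at h3
    rw [e1]
    rw [hI] at *
    linarith

end MatrixWalk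
namespace MatrixWalk

/-! ### Walsh coefficients in a fixed direction -/

/-- The Walsh character with index `u` at `w`. -/
noncomputable def walsh (u w : Finset ℕ) : ℝ := ∏ r ∈ u, if r ∈ w then -1 else 1

theorem walsh_comm (u w : Finset ℕ) : walsh u w = walsh w u := by
  unfold walsh
  rw [Finset.prod_ite_mem, Finset.prod_ite_mem, Finset.inter_comm]

theorem walsh_symmDiff (u w : Finset ℕ) (s : ℕ) :
    walsh (symmDiff u {s}) w = walsh u w * if s ∈ w then -1 else 1 := by
  unfold walsh
  by_cases hs : s ∈ u
  · have h : symmDiff u {s} = u.erase s := by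
      ext r; simp only [Finset.mem_symmDiff, Finset.mem_singleton, Finset.mem_erase]
      by_cases hr : r = s
      · subst hr; simp [hs]
      · simp [hr]
    rw [h, ← Finset.prod_erase_mul u _ hs, mul_assoc]
    split_ifs <;> simp
  · have h : symmDiff u {s} = insert s u := by
      ext r; simp only [Finset.mem_symmDiff, Finset.mem_singleton, Finset.mem_insert]
      by_cases hr : r = s
      · subst hr; simp [hs]
      · simp [hr]
    rw [h, Finset.prod_insert hs, mul_comm]

theorem walsh_symmDiff_right (u w : Finset ℕ) (s : ℕ) :
    walsh u (symmDiff w {s}) = walsh u w * if s ∈ u then -1 else 1 := by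
  rw [walsh_comm, walsh_symmDiff, walsh_comm]

/-- The sum factorises into ∏ (1 ± 1), and any element of w contributes a zero factor. -/
theorem sum_walsh {x : ℕ} {w : Finset ℕ} (hw : w ⊆ Finset.range x) :
    ∑ u ∈ (Finset.range x).powerset, walsh u w = if w = ∅ then 2 ^ x else 0 := by
  unfold walsh
  rw [← Finset.prod_one_add]
  split_ifs with h
  · subst h
    simp only [Finset.notMem_empty, if_false, Finset.prod_const, Finset.card_range]
    norm_num
  · obtain ⟨r, hr⟩ := Finset.nonempty_iff_ne_empty.2 h
    exact Finset.prod_eq_zero (hw hr) (by simp [hr])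

theorem symmDiff_singleton_subset {x s : ℕ} {w : Finset ℕ} (hs : s < x)
    (hw : w ⊆ Finset.range x) : symmDiff w {s} ⊆ Finset.range x := by
  intro r hr
  simp only [Finset.mem_symmDiff, Finset.mem_singleton] at hr
  rcases hr with hr | hr
  · exact hw hr.1
  · rw [hr.1]; exact Finset.mem_range.2 hs

section Coefficients

variable {V : Type*} [AddCommGroup V]

/-- Add `p` to the rows in `w`. -/
def shiftRows (p : V) (w : Finset ℕ) (U : ℕ → V) : ℕ → V := fun r => U r + if r ∈ w then p else 0

/-- The Walsh coefficient with index `u` of `f` along the multiples of `p` in the rows below `x`. -/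
noncomputable def walshCoeff (p : V) (x : ℕ) (f : (ℕ → V) → ℝ) (u : Finset ℕ) (U : ℕ → V) : ℝ :=
  (∑ w ∈ (Finset.range x).powerset, walsh u w * f (shiftRows p w U)) / 2 ^ x

theorem shiftRows_empty (p : V) (U : ℕ → V) : shiftRows p ∅ U = U := by
  funext r; simp [shiftRows]

theorem abs_walshCoeff_le (p : V) (x : ℕ) {f : (ℕ → V) → ℝ} {B : ℝ} (hf : ∀ U, |f U| ≤ B)
    (u : Finset ℕ) (U : ℕ → V) : |walshCoeff p x f u U| ≤ B := by
  unfold walshCoeff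
  rw [abs_div, abs_of_pos (show (0 : ℝ) < 2 ^ x by positivity), div_le_iff₀ (by positivity)]
  refine (Finset.abs_sum_le_sum_abs _ _).trans ?_
  refine (Finset.sum_le_card_nsmul _ _ B fun w _ => ?_).trans ?_
  · rw [abs_mul]
    have : |walsh u w| = 1 := by
      unfold walsh
      rw [Finset.abs_prod]
      refine Finset.prod_eq_one fun r _ => ?_
      split_ifs <;> simp
    rw [this, one_mul]
    exact hf _
  · simp [mul_comm]

/-- Fourier inversion. A coefficient is a function of U that already contains its character, so no
character appears in the sum. -/
theorem sum_walshCoeff (p : V) (x : ℕ) (f : (ℕ → V) → ℝ) (U : ℕ → V) :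
    ∑ u ∈ (Finset.range x).powerset, walshCoeff p x f u U = f U := by
  unfold walshCoeff
  rw [← Finset.sum_div, Finset.sum_comm]
  simp only [← Finset.sum_mul]
  rw [Finset.sum_congr rfl fun w hw => by rw [sum_walsh (Finset.mem_powerset.1 hw)]]
  simp [ite_mul, shiftRows_empty]

variable [Module (ZMod 2) V]

theorem shiftRows_shiftRows_singleton (p : V) (w : Finset ℕ) (s : ℕ) (U : ℕ → V) :
    shiftRows p w (shiftRows p {s} U) = shiftRows p (symmDiff w {s}) U := by
  funext r
  simp only [shiftRows, Finset.mem_symmDiff, Finset.mem_singleton]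
  by_cases hr : r = s <;> by_cases hw : r ∈ w
  · subst hr; simp [hw, add_assoc, ZModModule.add_self]
  · subst hr; simp [hw]
  · simp [hr, hw]
  · simp [hr, hw]

/-- Substituting w ∆ {s} for w shows that the coefficient is an eigenfunction of each shift by p. -/
theorem walshCoeff_shiftRows (p : V) {x s : ℕ} (hs : s < x) (f : (ℕ → V) → ℝ) (u : Finset ℕ)
    (U : ℕ → V) : walshCoeff p x f u (shiftRows p {s} U)
      = (if s ∈ u then -1 else 1) * walshCoeff p x f u U := by
  unfold walshCoeff
  rw [← mul_div_assoc, Finset.mul_sum]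
  congr 1
  refine Finset.sum_nbij' (fun w => symmDiff w {s}) (fun w => symmDiff w {s}) ?_ ?_ ?_ ?_ ?_
  · exact fun w hw => Finset.mem_powerset.2 (symmDiff_singleton_subset hs (Finset.mem_powerset.1 hw))
  · exact fun w hw => Finset.mem_powerset.2 (symmDiff_singleton_subset hs (Finset.mem_powerset.1 hw))
  · exact fun w _ => symmDiff_symmDiff_cancel_right _ _
  · exact fun w _ => symmDiff_symmDiff_cancel_right _ _
  · intro w _
    rw [shiftRows_shiftRows_singleton, walsh_symmDiff_right]
    split_ifs <;> ring

theorem walshCoeff_eq_zero (p : V) {x s : ℕ} (hs : s < x) {f : (ℕ → V) → ℝ}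
    (hf : ∀ U, f (shiftRows p {s} U) = f U) {u : Finset ℕ} (hu : s ∈ u) (U : ℕ → V) :
    walshCoeff p x f u U = 0 := by
  have h1 := walshCoeff_shiftRows p hs f u U
  have h2 : walshCoeff p x f u (shiftRows p {s} U) = walshCoeff p x f u U := by
    unfold walshCoeff
    congr 1
    refine Finset.sum_congr rfl fun w _ => ?_
    rw [shiftRows_shiftRows_singleton]
    congr 1
    rw [← hf (shiftRows p w U)]
    congr 1
    funext r
    simp only [shiftRows, Finset.mem_symmDiff, Finset.mem_singleton]
    by_cases hr : r = s <;> by_cases hw : r ∈ w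
    · subst hr; simp [hw, add_assoc, ZModModule.add_self]
    · subst hr; simp [hw]
    · simp [hr, hw]
    · simp [hr, hw]
  rw [h2, if_pos hu] at h1
  linarith

/-! ### One cell of the time grid -/

/-- Add `b` times the next row to row `y`, the row `x` being `r`. -/
def rowOp (x : ℕ) (r : V) (y : ℕ) (b : ZMod 2) (U : ℕ → V) : ℕ → V :=
  Function.update U y (U y + b • if y + 1 = x then r else U (y + 1))

theorem rowOp_zero (x : ℕ) (r : V) (y : ℕ) (U : ℕ → V) : rowOp x r y 0 U = U := by
  simp [rowOp]

theorem rowOp_shiftRows (p : V) {x y : ℕ} (r : V) (hy : y + 1 < x) (w : Finset ℕ) (U : ℕ → V) :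
    rowOp x r y 1 (shiftRows p w U)
      = shiftRows p (if y + 1 ∈ w then symmDiff w {y} else w) (rowOp x r y 1 U) := by
  funext s
  simp only [rowOp, if_neg hy.ne, one_smul]
  by_cases hs : s = y
  · subst hs
    rw [Function.update_self]
    simp only [shiftRows, Function.update_self]
    by_cases h1 : s + 1 ∈ w
    · simp only [h1, if_true, Finset.mem_symmDiff, Finset.mem_singleton]
      by_cases h2 : s ∈ w
      · simp only [h2, if_true, not_true, and_false, or_self, if_false]
        rw [add_add_add_comm, ZModModule.add_self]
      · simp [h2, add_assoc]
    · simp only [h1, if_false]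
      by_cases h2 : s ∈ w
      · simp [h2]; abel
      · simp [h2]
  · rw [Function.update_of_ne hs]
    simp only [shiftRows, Function.update_of_ne hs]
    congr 2
    by_cases h1 : y + 1 ∈ w
    · simp [h1, Finset.mem_symmDiff, hs]
    · simp [h1]

/-- Transposition over 𝔽₂: toggling w at y and u at y + 1 changes the pairing of u and w by terms
that cancel modulo 2. This is where the East constraint comes from. -/
theorem walsh_flip {y : ℕ} (u w : Finset ℕ) :
    walsh (eastFlip y u) (if y + 1 ∈ w then symmDiff w {y} else w) = walsh u w := by
  unfold eastFlip
  by_cases h1 : y ∈ u <;> by_cases h2 : y + 1 ∈ w <;>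
    simp [h1, h2, walsh_symmDiff, walsh_symmDiff_right, Finset.mem_symmDiff]

theorem walshCoeff_rowOp (p : V) {x y : ℕ} (r : V) (hy : y + 1 < x) (f : (ℕ → V) → ℝ)
    (u : Finset ℕ) (U : ℕ → V) :
    walshCoeff p x (fun U => f (rowOp x r y 1 U)) u U
      = walshCoeff p x f (eastFlip y u) (rowOp x r y 1 U) := by
  unfold walshCoeff
  congr 1
  have hmem : ∀ w ∈ (Finset.range x).powerset,
      (if y + 1 ∈ w then symmDiff w {y} else w) ∈ (Finset.range x).powerset := by
    intro w hw
    split_ifs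
    · exact Finset.mem_powerset.2
        (symmDiff_singleton_subset (by omega) (Finset.mem_powerset.1 hw))
    · exact hw
  have hinv : ∀ w : Finset ℕ, (if y + 1 ∈ (if y + 1 ∈ w then symmDiff w {y} else w) then
      symmDiff (if y + 1 ∈ w then symmDiff w {y} else w) {y}
      else (if y + 1 ∈ w then symmDiff w {y} else w)) = w := by
    intro w
    by_cases h : y + 1 ∈ w
    · simp [h, Finset.mem_symmDiff, symmDiff_symmDiff_cancel_right]
    · simp [h]
  refine Finset.sum_nbij' (fun w => if y + 1 ∈ w then symmDiff w {y} else w)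
    (fun w => if y + 1 ∈ w then symmDiff w {y} else w) hmem hmem (fun w _ => hinv w)
    (fun w _ => hinv w) ?_
  intro w _
  beta_reduce
  rw [rowOp_shiftRows p r hy, walsh_flip]

theorem rowOp_last_shiftRows (p : V) {y : ℕ} (r : V) (w : Finset ℕ) (U : ℕ → V) :
    rowOp (y + 1) r y 1 (shiftRows p w U) = shiftRows p w (rowOp (y + 1) r y 1 U) := by
  funext s
  simp only [rowOp, if_true, one_smul]
  by_cases hs : s = y
  · subst hs
    rw [Function.update_self]
    simp only [shiftRows, Function.update_self]
    abel
  · rw [Function.update_of_ne hs]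
    simp only [shiftRows, Function.update_of_ne hs]

/-- Row x is not among the shifted rows, so adding it to row x - 1 commutes with every shift and the
index u stays put. -/
theorem walshCoeff_rowOp_last (p : V) {y : ℕ} (r : V) (f : (ℕ → V) → ℝ)
    (u : Finset ℕ) (U : ℕ → V) :
    walshCoeff p (y + 1) (fun U => f (rowOp (y + 1) r y 1 U)) u U
      = walshCoeff p (y + 1) f u (rowOp (y + 1) r y 1 U) := by
  unfold walshCoeff
  simp only [rowOp_last_shiftRows]

/-- Adding p to row y is itself a shift. The sign -1 for y ∈ u cancels against the bit 0, and this
is the killing. -/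
theorem walshCoeff_rowOp_self (p : V) {y : ℕ} (f : (ℕ → V) → ℝ) (u : Finset ℕ) (U : ℕ → V) :
    walshCoeff p (y + 1) (fun U => f (rowOp (y + 1) p y 1 U)) u U
      = (if y ∈ u then -1 else 1) * walshCoeff p (y + 1) f u U := by
  rw [walshCoeff_rowOp_last, ← walshCoeff_shiftRows p (Nat.lt_succ_self y)]
  congr 1
  funext s
  simp only [rowOp, if_true, one_smul, shiftRows, Finset.mem_singleton]
  by_cases hs : s = y
  · subst hs; simp
  · simp [hs]

/-- The weight of the outcome of a cell of length `h`: either no row below `x` rings, or exactly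
one of them rings once, with a given bit. Only the first outcome is allowed if `ρ = none`. -/
noncomputable def cellWeight (x : ℕ) (h : ℝ) (ρ : Option V) : Option (Fin x × ZMod 2) → ℝ
  | none => Real.exp (-(x * h))
  | some _ => Real.exp (-(x * h)) * if ρ.isSome then h / 2 else 0

/-- The effect of the outcome of a cell in which row `x` is constant. -/
def cellMap (x : ℕ) (ρ : Option V) : Option (Fin x × ZMod 2) → (ℕ → V) → (ℕ → V)
  | none, U => U
  | some (y, b), U => rowOp x (ρ.getD 0) y b U

/-- The operator of a cell. -/
noncomputable def cellOp (x : ℕ) (h : ℝ) (ρ : Option V) (f : (ℕ → V) → ℝ) (U : ℕ → V) : ℝ :=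
  ∑ o, cellWeight x h ρ o * f (cellMap x ρ o U)

theorem sum_zmod_two (φ : ZMod 2 → ℝ) : ∑ b, φ b = φ 0 + φ 1 := Fin.sum_univ_two φ

theorem cellOp_none (x : ℕ) (h : ℝ) (f : (ℕ → V) → ℝ) (U : ℕ → V) :
    cellOp x h none f U = Real.exp (-(x * h)) * f U := by
  simp [cellOp, Fintype.sum_option, cellWeight, cellMap]

theorem cellOp_some (x : ℕ) (h : ℝ) (r : V) (f : (ℕ → V) → ℝ) (U : ℕ → V) :
    cellOp x h (some r) f U = Real.exp (-(x * h)) * (f U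
      + h * ∑ y ∈ Finset.range x, (f U + f (rowOp x r y 1 U)) / 2) := by
  simp only [cellOp, Fintype.sum_option, cellWeight, cellMap, Fintype.sum_prod_type, sum_zmod_two,
    Option.isSome_some, if_true, Option.getD_some, rowOp_zero]
  rw [mul_add, Finset.mul_sum, Finset.mul_sum, Finset.sum_range]
  congr 1
  refine Finset.sum_congr rfl fun y _ => ?_
  ring

/-- The evolution through a cell of bounds for the Walsh coefficients. -/
noncomputable def cellBound (x : ℕ) (h : ℝ) (kill : Prop) [Decidable kill] (n : Finset ℕ → ℝ)
    (u : Finset ℕ) : ℝ :=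
  Real.exp (-(x * h)) * (n u + h * ∑ y ∈ Finset.range x,
    if y + 1 = x then (if kill ∧ y ∈ u then 0 else n u) else (n u + n (eastFlip y u)) / 2)

theorem walshCoeff_cellOp_some (p : V) (x : ℕ) (h : ℝ) (r : V) (f : (ℕ → V) → ℝ) (u : Finset ℕ)
    (U : ℕ → V) : walshCoeff p x (cellOp x h (some r) f) u U
      = Real.exp (-(x * h)) * (walshCoeff p x f u U + h * ∑ y ∈ Finset.range x,
        (walshCoeff p x f u U + walshCoeff p x (fun U => f (rowOp x r y 1 U)) u U) / 2) := by
  have : cellOp x h (some r) f = fun U => Real.exp (-(x * h)) * (f U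
      + h * ∑ y ∈ Finset.range x, (f U + f (rowOp x r y 1 U)) / 2) :=
    funext fun U => cellOp_some x h r f U
  rw [this]
  simp only [walshCoeff, mul_add, add_div, Finset.mul_sum, Finset.sum_add_distrib, Finset.sum_div]
  congr 1
  · refine Finset.sum_congr rfl fun w _ => ?_
    ring
  · congr 1
    · rw [Finset.sum_comm]
      refine Finset.sum_congr rfl fun w _ => Finset.sum_congr rfl fun y _ => ?_
      ring
    · rw [Finset.sum_comm]
      refine Finset.sum_congr rfl fun w _ => Finset.sum_congr rfl fun y _ => ?_
      ring

theorem eastFlip_subset {a x y : ℕ} (hy : y + 1 < x) {u : Finset ℕ} (hu : u ⊆ Finset.Ico a x) :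
    eastFlip y u ⊆ Finset.Ico a x := by
  unfold eastFlip
  split_ifs with h
  · intro s hs
    simp only [Finset.mem_symmDiff, Finset.mem_singleton] at hs
    rcases hs with hs | hs
    · exact hu hs.1
    · have := Finset.mem_Ico.1 (hu h)
      rw [hs.1, Finset.mem_Ico]
      omega
  · exact hu

/-- Row operations also move the point U at which coefficients are evaluated. Bounds uniform in U
are insensitive to this, and the killing survives because it is an exact cancellation at a single U.
-/
theorem abs_walshCoeff_cellOp_le (p : V) (x : ℕ) {h : ℝ} (hh : 0 ≤ h) (r : V) [Decidable (r = p)]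
    {f : (ℕ → V) → ℝ} {n : Finset ℕ → ℝ}
    (hf : ∀ u ⊆ Finset.range x, ∀ U, |walshCoeff p x f u U| ≤ n u) {u : Finset ℕ}
    (hu : u ⊆ Finset.range x) (U : ℕ → V) :
    |walshCoeff p x (cellOp x h (some r) f) u U| ≤ cellBound x h (r = p) n u := by
  rw [walshCoeff_cellOp_some, cellBound, abs_mul, abs_of_pos (Real.exp_pos _)]
  refine mul_le_mul_of_nonneg_left ?_ (Real.exp_pos _).le
  refine (abs_add_le _ _).trans (add_le_add (hf u hu U) ?_)
  rw [abs_mul, abs_of_nonneg hh]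
  refine mul_le_mul_of_nonneg_left ?_ hh
  refine (Finset.abs_sum_le_sum_abs _ _).trans (Finset.sum_le_sum fun y hy => ?_)
  have hyx := Finset.mem_range.1 hy
  rw [abs_div, abs_of_pos (show (0 : ℝ) < 2 by norm_num)]
  by_cases h1 : y + 1 = x
  · rw [if_pos h1]
    subst h1
    by_cases h2 : r = p ∧ y ∈ u
    · rw [if_pos h2, h2.1, walshCoeff_rowOp_self, if_pos h2.2]
      simp
    · rw [if_neg h2, walshCoeff_rowOp_last, div_le_iff₀ (by norm_num)]
      refine (abs_add_le _ _).trans ?_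
      have := hf u hu U
      have := hf u hu (rowOp (y + 1) r y 1 U)
      linarith
  · rw [if_neg h1, walshCoeff_rowOp p r (by omega)]
    have hu' : eastFlip y u ⊆ Finset.range x := by
      rw [Finset.range_eq_Ico] at hu ⊢
      exact eastFlip_subset (by omega) hu
    refine div_le_div_of_nonneg_right ((abs_add_le _ _).trans ?_) (by norm_num)
    exact add_le_add (hf u hu U) (hf _ hu' _)

theorem walshCoeff_cellOp_none (p : V) (x : ℕ) (h : ℝ) (f : (ℕ → V) → ℝ) (u : Finset ℕ)
    (U : ℕ → V) : walshCoeff p x (cellOp x h none f) u U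
      = Real.exp (-(x * h)) * walshCoeff p x f u U := by
  simp only [walshCoeff, cellOp_none, ← mul_div_assoc, Finset.mul_sum]
  congr 1
  refine Finset.sum_congr rfl fun w _ => ?_
  ring

end Coefficients

/-! ### Contraction of the bounds -/

theorem sum_eastFlip {a x y : ℕ} (hy : y + 1 < x) (φ : Finset ℕ → ℝ) :
    ∑ u ∈ (Finset.Ico a x).powerset, φ (eastFlip y u) = ∑ u ∈ (Finset.Ico a x).powerset, φ u :=
  Finset.sum_nbij' (eastFlip y) (eastFlip y)
    (fun _ hu => Finset.mem_powerset.2 (eastFlip_subset hy (Finset.mem_powerset.1 hu)))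
    (fun _ hu => Finset.mem_powerset.2 (eastFlip_subset hy (Finset.mem_powerset.1 hu)))
    (fun _ _ => eastFlip_eastFlip _ _) (fun _ _ => eastFlip_eastFlip _ _) fun _ _ => rfl

/-- One cell contracts the Euclidean norm of the bounds, up to second order, at a rate which does
not depend on the number of rows if row `x` shows the pattern. -/
theorem sum_sq_cellBound_le {a x : ℕ} (hax : a ≤ x) {h : ℝ} (hh : 0 ≤ h) (kill : Prop)
    [Decidable kill] {n : Finset ℕ → ℝ} (h0 : n ∅ = 0) :
    ∑ u ∈ (Finset.Ico a x).powerset, cellBound x h kill n u ^ 2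
      ≤ Real.exp (2 * (x * h) ^ 2 - if kill then h / 134 else 0)
        * ∑ u ∈ (Finset.Ico a x).powerset, n u ^ 2 := by
  rcases x with _ | x
  -- With no rows below x, the only index is ∅, where the bound vanishes.
  · simp [cellBound, h0]
  set P := (Finset.Ico a (x + 1)).powerset with hP
  set K : ℕ → Finset ℕ → ℝ := fun y u =>
    if y + 1 = x + 1 then (if kill ∧ y ∈ u then n u else 0) else (n u - n (eastFlip y u)) / 2
    with hK
  set X : ℝ := ((x + 1 : ℕ) : ℝ) with hX
  have hX0 : 0 ≤ X := Nat.cast_nonneg _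
  have hb : ∀ u, cellBound (x + 1) h kill n u
      = Real.exp (-(X * h)) * ((1 + X * h) * n u - h * ∑ y ∈ Finset.range (x + 1), K y u) := by
    intro u
    unfold cellBound
    congr 1
    have : ∀ y, (if y + 1 = x + 1 then (if kill ∧ y ∈ u then 0 else n u)
        else (n u + n (eastFlip y u)) / 2) = n u - K y u := by
      intro y
      simp only [hK]
      split_ifs <;> ring
    simp only [this, Finset.sum_sub_distrib, Finset.sum_const, Finset.card_range, nsmul_eq_mul]
    ring
  set S := ∑ u ∈ P, n u ^ 2 with hS
  have hS0 : 0 ≤ S := Finset.sum_nonneg fun _ _ => sq_nonneg _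
  have hflip : ∀ y, y < x → ∑ u ∈ P, n u * K y u
      = (∑ u ∈ P, (n (eastFlip y u) - n u) ^ 2) / 4 := by
    intro y hy
    have h1 := sum_eastFlip (a := a) (x := x + 1) (y := y) (by omega) fun u => n u ^ 2
    have h2 : ∑ u ∈ P, (n (eastFlip y u) - n u) ^ 2
        = ∑ u ∈ P, n (eastFlip y u) ^ 2 + ∑ u ∈ P, n u ^ 2
          - 2 * ∑ u ∈ P, n u * n (eastFlip y u) := by
      rw [Finset.mul_sum, ← Finset.sum_add_distrib, ← Finset.sum_sub_distrib]
      exact Finset.sum_congr rfl fun u _ => by ring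
    have h3 : ∑ u ∈ P, n u * K y u
        = (∑ u ∈ P, n u ^ 2 - ∑ u ∈ P, n u * n (eastFlip y u)) / 2 := by
      rw [← Finset.sum_sub_distrib, Finset.sum_div]
      refine Finset.sum_congr rfl fun u _ => ?_
      simp only [hK, if_neg (show y + 1 ≠ x + 1 by omega)]
      ring
    rw [h3, h2, h1]
    ring
  set q := ∑ u ∈ P, n u * ∑ y ∈ Finset.range (x + 1), K y u with hq
  have hq' : q = (∑ y ∈ Finset.range x, ∑ u ∈ P, (n (eastFlip y u) - n u) ^ 2) / 4
      + ∑ u ∈ P, (if kill ∧ x ∈ u then n u ^ 2 else 0) := by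
    rw [hq]
    simp only [Finset.mul_sum]
    rw [Finset.sum_comm, Finset.sum_range_succ, Finset.sum_div]
    congr 1
    · exact Finset.sum_congr rfl fun y hy => hflip y (Finset.mem_range.1 hy)
    · refine Finset.sum_congr rfl fun u _ => ?_
      simp only [hK, if_true]
      split_ifs <;> ring
  -- With D the Dirichlet sum and V the killed part, `east_spectral` gives S ≤ 67 (V + D) ≤ 268 (V +
  -- D / 4), and q is at least V + D / 4.
  have hqlow : (if kill then h / 134 else 0) * S ≤ 2 * h * q := by
    have hD0 : 0 ≤ ∑ y ∈ Finset.range x, ∑ u ∈ P, (n (eastFlip y u) - n u) ^ 2 :=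
      Finset.sum_nonneg fun _ _ => Finset.sum_nonneg fun _ _ => sq_nonneg _
    by_cases hk : kill
    · simp only [hk, if_true, true_and] at hq' ⊢
      obtain ⟨d, hd⟩ := Nat.exists_eq_add_of_le hax
      have hE := east_spectral a d n h0
      rw [← hd, show x + 1 - 1 = x by omega, ← hP] at hE
      have hV0 : 0 ≤ ∑ u ∈ P, (if x ∈ u then n u ^ 2 else 0) :=
        Finset.sum_nonneg fun _ _ => by positivity
      have hle : ∑ u ∈ P, ∑ y ∈ Finset.Ico a x, (n (eastFlip y u) - n u) ^ 2
          ≤ ∑ y ∈ Finset.range x, ∑ u ∈ P, (n (eastFlip y u) - n u) ^ 2 := by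
        rw [Finset.sum_comm (s := Finset.range x)]
        refine Finset.sum_le_sum fun u _ => Finset.sum_le_sum_of_subset_of_nonneg ?_
          fun _ _ _ => sq_nonneg _
        intro y; simp
      have : S ≤ 268 * q := by rw [hq']; linarith
      have := mul_le_mul_of_nonneg_left this hh
      linarith
    · simp only [hk, if_false, false_and, Finset.sum_const_zero, add_zero, zero_mul] at hq' ⊢
      rw [hq']
      positivity
  -- Each K y is an ℓ² contraction, because flips permute the indices; Cauchy–Schwarz then sums over
  -- y. This only enters at second order in h.
  have hKsq : ∑ u ∈ P, (∑ y ∈ Finset.range (x + 1), K y u) ^ 2 ≤ X ^ 2 * S := by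
    have h1 : ∀ y ∈ Finset.range (x + 1), ∑ u ∈ P, K y u ^ 2 ≤ S := by
      intro y hy
      rcases Nat.lt_succ_iff_lt_or_eq.1 (Finset.mem_range.1 hy) with hy | hy
      · have h1 := sum_eastFlip (a := a) (x := x + 1) (y := y) (by omega) fun u => n u ^ 2
        have h2 : ∑ u ∈ P, K y u ^ 2 ≤ (∑ u ∈ P, n u ^ 2 + ∑ u ∈ P, n (eastFlip y u) ^ 2) / 2 := by
          rw [← Finset.sum_add_distrib, Finset.sum_div]
          refine Finset.sum_le_sum fun u _ => ?_
          simp only [hK, if_neg (show y + 1 ≠ x + 1 by omega)]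
          nlinarith [sq_nonneg (n u + n (eastFlip y u))]
        rw [h1] at h2
        linarith
      · refine Finset.sum_le_sum fun u _ => ?_
        simp only [hK, hy, if_true]
        split_ifs
        · exact le_rfl
        · simpa using sq_nonneg (n u)
    calc ∑ u ∈ P, (∑ y ∈ Finset.range (x + 1), K y u) ^ 2
        ≤ ∑ u ∈ P, X * ∑ y ∈ Finset.range (x + 1), K y u ^ 2 := by
          refine Finset.sum_le_sum fun u _ => ?_
          have := sq_sum_le_card_mul_sum_sq (s := Finset.range (x + 1)) (f := fun y => K y u)
          rwa [Finset.card_range] at this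
      _ = X * ∑ y ∈ Finset.range (x + 1), ∑ u ∈ P, K y u ^ 2 := by
          rw [← Finset.mul_sum, Finset.sum_comm]
      _ ≤ X * ∑ _y ∈ Finset.range (x + 1), S :=
          mul_le_mul_of_nonneg_left (Finset.sum_le_sum h1) hX0
      _ = X ^ 2 * S := by
          rw [Finset.sum_const, Finset.card_range, nsmul_eq_mul, sq, mul_assoc]
  have hmain : ∑ u ∈ P, cellBound (x + 1) h kill n u ^ 2
      = Real.exp (-(X * h)) ^ 2 * ((1 + X * h) ^ 2 * S - 2 * h * (1 + X * h) * q
        + h ^ 2 * ∑ u ∈ P, (∑ y ∈ Finset.range (x + 1), K y u) ^ 2) := by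
    rw [hS, hq, Finset.mul_sum, Finset.mul_sum, Finset.mul_sum, ← Finset.sum_sub_distrib,
      ← Finset.sum_add_distrib, Finset.mul_sum]
    refine Finset.sum_congr rfl fun u _ => ?_
    rw [hb]
    ring
  rw [hmain]
  set c : ℝ := if kill then h / 134 else 0 with hc
  have hc0 : 0 ≤ c := by rw [hc]; positivity
  have hXh : 0 ≤ X * h := by positivity
  have hbr : (1 + X * h) ^ 2 * S - 2 * h * (1 + X * h) * q
        + h ^ 2 * ∑ u ∈ P, (∑ y ∈ Finset.range (x + 1), K y u) ^ 2
      ≤ (2 * (X * h) + 2 * (X * h) ^ 2 - c + 1) * S := by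
    have h1 := mul_le_mul_of_nonneg_left hKsq (sq_nonneg h)
    have h2 := mul_le_mul_of_nonneg_left hqlow (show 0 ≤ 1 + X * h by positivity)
    have h3 : 0 ≤ X * h * (c * S) := by positivity
    nlinarith
  have hexp : Real.exp (-(X * h)) ^ 2 * Real.exp (2 * (X * h) + 2 * (X * h) ^ 2 - c)
      = Real.exp (2 * (X * h) ^ 2 - c) := by
    rw [sq, ← Real.exp_add, ← Real.exp_add]
    congr 1
    ring
  rw [← hexp, mul_assoc (Real.exp (-(X * h)) ^ 2)]
  refine mul_le_mul_of_nonneg_left (hbr.trans ?_) (by positivity)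
  exact mul_le_mul_of_nonneg_right (Real.add_one_le_exp _) hS0

end MatrixWalk
namespace MatrixWalk

/-! ### The grid -/

section Grid

variable {V : Type*}

theorem sum_cellWeight (x : ℕ) (h : ℝ) (ρ : Option V) :
    ∑ o, cellWeight x h ρ o = Real.exp (-(x * h)) * if ρ.isSome then 1 + x * h else 1 := by
  simp only [Fintype.sum_option, cellWeight, Finset.sum_const, Finset.card_univ, Fintype.card_prod,
    Fintype.card_fin, ZMod.card, nsmul_eq_mul]
  split_ifs
  · push_cast; ring
  · simp

theorem one_sub_sum_le_prod {N : ℕ} {s e : ℕ → ℝ} (he : ∀ c, 0 ≤ e c)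
    (hs : ∀ c, 1 - e c ≤ s c)
    (hs0 : ∀ c, 0 ≤ s c) (hs1 : ∀ c, s c ≤ 1) :
    1 - ∑ c ∈ Finset.range N, e c ≤ ∏ c ∈ Finset.range N, s c := by
  induction N with
  | zero => simp
  | succ N ih =>
    rw [Finset.sum_range_succ, Finset.prod_range_succ]
    have h1 : ∏ c ∈ Finset.range N, s c ≤ 1 := Finset.prod_le_one (fun c _ => hs0 c) fun c _ => hs1 c
    have h0 : 0 ≤ ∏ c ∈ Finset.range N, s c := Finset.prod_nonneg fun c _ => hs0 c
    have := he N
    nlinarith [hs N, hs0 N, hs1 N, mul_nonneg (sub_nonneg.2 h1) (sub_nonneg.2 (hs1 N))]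

/-- The total weight of the outcomes. -/
theorem one_sub_le_sum_prod_cellWeight (x N : ℕ) {h : ℝ} (hh : 0 ≤ h) (ρ : ℕ → Option V) :
    1 - (N * (x * h) ^ 2 + ((Finset.range N).filter fun c => (ρ c).isNone).card * (x * h))
      ≤ ∑ o : Fin N → Option (Fin x × ZMod 2), ∏ c : Fin N, cellWeight x h (ρ c) (o c) := by
  have hz : 0 ≤ x * h := by positivity
  have hprod : ∑ o : Fin N → Option (Fin x × ZMod 2), ∏ c : Fin N, cellWeight x h (ρ c) (o c)
      = ∏ c ∈ Finset.range N, ∑ o, cellWeight x h (ρ c) o := by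
    rw [Finset.prod_range, Finset.prod_univ_sum, Fintype.piFinset_univ]
  have hexp := Real.add_one_le_exp (-(x * h))
  have hexp' := Real.add_one_le_exp (x * h)
  have hmul : Real.exp (-(x * h)) * Real.exp (x * h) = 1 := by rw [← Real.exp_add]; simp
  have hpos := Real.exp_pos (-(x * h))
  rw [hprod]
  -- With z = x h, a cell keeps mass e^{-z} (1 + z) ≥ 1 - z² if row x is quiet, and e^{-z} ≥ 1 - z
  -- otherwise.
  refine le_trans (le_of_eq ?_) (one_sub_sum_le_prod (N := N)
    (e := fun c => if (ρ c).isSome then (x * h) ^ 2 else x * h + (x * h) ^ 2) ?_ ?_ ?_ ?_)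
  · congr 1
    have : ∀ c, (if (ρ c).isSome then (x * h) ^ 2 else x * h + (x * h) ^ 2)
        = (x * h) ^ 2 + if (ρ c).isNone then x * h else 0 := by
      intro c
      cases ρ c <;> simp [add_comm]
    simp only [this, Finset.sum_add_distrib, ← Finset.sum_filter, Finset.sum_const,
      Finset.card_range, nsmul_eq_mul]
  · intro c
    positivity
  · intro c
    simp only [sum_cellWeight]
    split_ifs
    · nlinarith
    · nlinarith
  · intro c
    rw [sum_cellWeight]
    positivity
  · intro c
    simp only [sum_cellWeight]
    split_ifs
    · calc Real.exp (-(x * h)) * (1 + x * h) ≤ Real.exp (-(x * h)) * Real.exp (x * h) :=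
          mul_le_mul_of_nonneg_left (by linarith) hpos.le
        _ = 1 := hmul
    · rw [mul_one]; exact Real.exp_le_one_iff.2 (by linarith)

variable [AddCommGroup V] [Module (ZMod 2) V]

/-- The composition of the operators of the first `N` cells. -/
noncomputable def gridOp (x : ℕ) (h : ℝ) (ρ : ℕ → Option V) :
    ℕ → ((ℕ → V) → ℝ) → (ℕ → V) → ℝ
  | 0, f, U => f U
  | N + 1, f, U => gridOp x h ρ N (cellOp x h (ρ N) f) U

/-- The effect of the outcomes of the first `N` cells. -/
def gridMap (x : ℕ) (ρ : ℕ → Option V) (o : ℕ → Option (Fin x × ZMod 2)) (U : ℕ → V) : ℕ → ℕ → V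
  | 0 => U
  | N + 1 => cellMap x (ρ N) (o N) (gridMap x ρ o U N)

theorem gridMap_congr {x : ℕ} {ρ : ℕ → Option V} {o o' : ℕ → Option (Fin x × ZMod 2)} {N : ℕ}
    (h : ∀ c < N, o c = o' c) (U : ℕ → V) : gridMap x ρ o U N = gridMap x ρ o' U N := by
  induction N with
  | zero => rfl
  | succ N ih =>
    simp only [gridMap]
    rw [ih fun c hc => h c (by omega), h N (by omega)]

/-- Extend finitely many outcomes by `none`. -/
def extendOutcome {x N : ℕ} (o : Fin N → Option (Fin x × ZMod 2)) (c : ℕ) :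
    Option (Fin x × ZMod 2) := if h : c < N then o ⟨c, h⟩ else none

theorem gridOp_eq_sum (x : ℕ) (h : ℝ) (ρ : ℕ → Option V) (N : ℕ) (f : (ℕ → V) → ℝ) (U : ℕ → V) :
    gridOp x h ρ N f U = ∑ o : Fin N → Option (Fin x × ZMod 2),
      (∏ c : Fin N, cellWeight x h (ρ c) (o c)) * f (gridMap x ρ (extendOutcome o) U N) := by
  induction N generalizing f with
  | zero => simp [gridOp, gridMap]
  | succ N ih =>
    rw [gridOp, ih, ← (Fin.snocEquiv fun _ => Option (Fin x × ZMod 2)).sum_comp,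
      Fintype.sum_prod_type, Finset.sum_comm]
    refine Finset.sum_congr rfl fun o _ => ?_
    rw [cellOp, Finset.mul_sum]
    refine Finset.sum_congr rfl fun v _ => ?_
    simp only [Fin.snocEquiv, Equiv.coe_fn_mk, Fin.prod_univ_castSucc, Fin.snoc_castSucc,
      Fin.snoc_last, Fin.val_castSucc, Fin.val_last, gridMap]
    rw [mul_assoc]
    congr 4
    · simp only [extendOutcome, Nat.lt_succ_self, dif_pos]
      exact (Fin.snoc_last (α := fun _ => Option (Fin x × ZMod 2)) v o).symm
    · refine gridMap_congr (fun c hc => ?_) U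
      simp only [extendOutcome, hc, dif_pos, show c < N + 1 by omega]
      exact (Fin.snoc_castSucc (α := fun _ => Option (Fin x × ZMod 2)) v o ⟨c, hc⟩).symm

/-- A flip adds or removes only y + 1, and y itself stays. Hence bounds that vanish on indices
reaching below a continue to do so. -/
theorem subset_of_eastFlip_subset {a x y : ℕ} {u : Finset ℕ} (hu : u ⊆ Finset.range x)
    (h : eastFlip y u ⊆ Finset.Ico a x) : u ⊆ Finset.Ico a x := by
  intro r hr
  have hrx := Finset.mem_range.1 (hu hr)
  unfold eastFlip at h
  split_ifs at h with hy
  · have hya := Finset.mem_Ico.1 (h (show y ∈ _ by simp [Finset.mem_symmDiff, hy]))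
    by_cases hr1 : r = y + 1
    · rw [Finset.mem_Ico]; omega
    · exact h (by simp [Finset.mem_symmDiff, hr, hr1])
  · exact h hr

theorem exists_cellOp_bound (p : V) [DecidableEq V] {a x : ℕ} (hax : a ≤ x) {h : ℝ} (hh : 0 ≤ h)
    (ρ : Option V) {f : (ℕ → V) → ℝ} {n : Finset ℕ → ℝ} (h0 : n ∅ = 0)
    (hn : ∀ u ⊆ Finset.range x, ¬ u ⊆ Finset.Ico a x → n u = 0)
    (hf : ∀ u ⊆ Finset.range x, ∀ U, |walshCoeff p x f u U| ≤ n u) :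
    ∃ n' : Finset ℕ → ℝ, n' ∅ = 0 ∧ (∀ u ⊆ Finset.range x, ¬ u ⊆ Finset.Ico a x → n' u = 0) ∧
      (∀ u ⊆ Finset.range x, ∀ U, |walshCoeff p x (cellOp x h ρ f) u U| ≤ n' u) ∧
      ∑ u ∈ (Finset.Ico a x).powerset, n' u ^ 2
        ≤ Real.exp (2 * (x * h) ^ 2 - if ρ = some p then h / 134 else 0)
          * ∑ u ∈ (Finset.Ico a x).powerset, n u ^ 2 := by
  cases ρ with
  | none =>
    refine ⟨fun u => Real.exp (-(x * h)) * n u, by simp [h0], fun u hu hu' => by simp [hn u hu hu'],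
      fun u hu U => ?_, ?_⟩
    · rw [walshCoeff_cellOp_none, abs_mul, abs_of_pos (Real.exp_pos _)]
      exact mul_le_mul_of_nonneg_left (hf u hu U) (Real.exp_pos _).le
    · simp only [mul_pow, ← Finset.mul_sum, reduceCtorEq, if_false, sub_zero]
      refine mul_le_mul_of_nonneg_right ?_ (Finset.sum_nonneg fun _ _ => sq_nonneg _)
      refine (pow_le_one₀ (Real.exp_pos _).le ?_).trans (Real.one_le_exp (by positivity))
      exact Real.exp_le_one_iff.2 (by simp; positivity)
  | some r =>
    refine ⟨cellBound x h (r = p) n, ?_, ?_, fun u hu U => abs_walshCoeff_cellOp_le p x hh r hf hu U,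
      ?_⟩
    · simp [cellBound, h0, eastFlip]
    · intro u hu hu'
      unfold cellBound
      rw [hn u hu hu', Finset.sum_eq_zero]
      · simp
      · intro y hy
        have hyx := Finset.mem_range.1 hy
        split_ifs with h1
        · rfl
        · rfl
        · rw [hn (eastFlip y u), add_zero, zero_div]
          · rw [Finset.range_eq_Ico] at hu ⊢
            exact eastFlip_subset (by omega) hu
          · exact fun h => hu' (subset_of_eastFlip_subset hu h)
    · simp only [Option.some.injEq]
      exact sum_sq_cellBound_le hax hh (r = p) h0

/-- The ℓ² contraction is iterated cell by cell; Cauchy–Schwarz is applied only once, to bound a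
function by the sum of its coefficients, so the factor 2 ^ (x - a) does not compound. -/
theorem sq_gridOp_le (p : V) [DecidableEq V] {a x : ℕ} (hax : a ≤ x) {h : ℝ} (hh : 0 ≤ h)
    (ρ : ℕ → Option V) (N : ℕ) {f : (ℕ → V) → ℝ} {n : Finset ℕ → ℝ} (h0 : n ∅ = 0)
    (hn : ∀ u ⊆ Finset.range x, ¬ u ⊆ Finset.Ico a x → n u = 0)
    (hf : ∀ u ⊆ Finset.range x, ∀ U, |walshCoeff p x f u U| ≤ n u) (U : ℕ → V) :
    gridOp x h ρ N f U ^ 2 ≤ 2 ^ (x - a)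
      * (Real.exp (∑ c ∈ Finset.range N, (2 * (x * h) ^ 2 - if ρ c = some p then h / 134 else 0))
        * ∑ u ∈ (Finset.Ico a x).powerset, n u ^ 2) := by
  induction N generalizing f n with
  | zero =>
    have h1 : |f U| ≤ ∑ u ∈ (Finset.Ico a x).powerset, n u := by
      rw [← sum_walshCoeff p x f U]
      refine (Finset.abs_sum_le_sum_abs _ _).trans ((Finset.sum_le_sum fun u hu =>
        hf u (Finset.mem_powerset.1 hu) U).trans (le_of_eq ?_))
      symm
      refine Finset.sum_subset (Finset.powerset_mono.2 ?_) ?_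
      · rw [Finset.range_eq_Ico]; exact Finset.Ico_subset_Ico_left (Nat.zero_le _)
      · intro u hu hu'
        exact hn u (Finset.mem_powerset.1 hu) fun h => hu' (Finset.mem_powerset.2 h)
    have h2 := sq_sum_le_card_mul_sum_sq (s := (Finset.Ico a x).powerset) (f := n)
    simp only [Finset.card_powerset, Nat.card_Ico, Nat.cast_pow, Nat.cast_ofNat] at h2
    simp only [gridOp, Finset.range_zero, Finset.sum_empty, Real.exp_zero, one_mul]
    rw [← sq_abs]
    exact (pow_le_pow_left₀ (abs_nonneg _) h1 2).trans h2
  | succ N ih =>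
    obtain ⟨n', h0', hn', hf', hle⟩ := exists_cellOp_bound p hax hh (ρ N) h0 hn hf
    rw [gridOp, Finset.sum_range_succ, Real.exp_add, mul_assoc (Real.exp _)]
    refine (ih h0' hn' hf').trans ?_
    gcongr

end Grid

end MatrixWalk
namespace MatrixWalk

/-! ### The law of one row of the noise -/

/-- The law of the waiting times and bits of one row. -/
noncomputable def rowLaw : Measure (ℕ → ℝ × ZMod 2) := Measure.infinitePi fun _ => stepLaw

instance : IsProbabilityMeasure rowLaw := by unfold rowLaw; infer_instance

instance (n : ℕ) : IsProbabilityMeasure (noiseLaw n) := by unfold noiseLaw; infer_instance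

/-- Put a term in front of a sequence. -/
def consSeq {α : Type*} (z : α) (w : ℕ → α) : ℕ → α
  | 0 => z
  | j + 1 => w j

theorem measurable_consSeq {α : Type*} [MeasurableSpace α] :
    Measurable fun p : α × (ℕ → α) => consSeq p.1 p.2 := by
  refine measurable_pi_lambda _ fun j => ?_
  cases j with
  | zero => exact measurable_fst
  | succ j => exact (measurable_pi_apply j).comp measurable_snd

theorem map_consSeq_rowLaw :
    (stepLaw.prod rowLaw).map (fun p => consSeq p.1 p.2) = rowLaw := by
  classical
  refine Measure.eq_infinitePi _ fun s t ht => ?_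
  obtain ⟨K, hK⟩ : ∃ K, s ⊆ Finset.range (K + 1) :=
    ⟨s.sup id, fun j hj => Finset.mem_range.2 (Nat.lt_succ_of_le (Finset.le_sup (f := id) hj))⟩
  set t' : ℕ → Set (ℝ × ZMod 2) := fun j => if j ∈ s then t j else Set.univ with ht'
  have hmt' : ∀ j, MeasurableSet (t' j) := by
    intro j
    simp only [ht']
    split_ifs
    · exact ht j
    · exact MeasurableSet.univ
  have hset : (s : Set ℕ).pi t = (Finset.range (K + 1) : Set ℕ).pi t' := by
    ext w
    simp only [Set.mem_pi, Finset.mem_coe, ht']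
    constructor
    · intro h j _
      split_ifs with hj
      · exact h j hj
      · trivial
    · intro h j hj
      simpa [hj] using h j (hK hj)
  have hprod : ∏ j ∈ s, stepLaw (t j) = ∏ j ∈ Finset.range (K + 1), stepLaw (t' j) := by
    rw [← Finset.prod_subset hK]
    · exact Finset.prod_congr rfl fun j hj => by simp [ht', hj]
    · intro j _ hj
      simp [ht', hj]
  have hpre : (fun p : (ℝ × ZMod 2) × (ℕ → ℝ × ZMod 2) => consSeq p.1 p.2) ⁻¹'
      ((Finset.range (K + 1) : Set ℕ).pi t')
      = t' 0 ×ˢ ((Finset.range K : Set ℕ).pi fun j => t' (j + 1)) := by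
    ext ⟨z, w⟩
    simp only [Set.mem_preimage, Set.mem_pi, Finset.coe_range, Set.mem_Iio, Set.mem_prod]
    constructor
    · exact fun h => ⟨h 0 (Nat.succ_pos _), fun j hj => h (j + 1) (Nat.succ_lt_succ hj)⟩
    · rintro ⟨h0, h1⟩ (_ | j) hj
      · exact h0
      · exact h1 j (Nat.succ_lt_succ_iff.1 hj)
  rw [hset, hprod, Measure.map_apply measurable_consSeq
    (MeasurableSet.pi (Finset.countable_toSet _) fun j _ => hmt' j), hpre, Measure.prod_prod,
    rowLaw, Measure.infinitePi_pi _ fun j _ => hmt' (j + 1), Finset.prod_range_succ', mul_comm]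

theorem rowLaw_apply_eq {A : Set (ℕ → ℝ × ZMod 2)} (hA : MeasurableSet A) :
    rowLaw A = ∫⁻ z, rowLaw {w | consSeq z w ∈ A} ∂stepLaw := by
  conv_lhs => rw [← map_consSeq_rowLaw]
  rw [Measure.map_apply measurable_consSeq hA,
    Measure.prod_apply (measurable_consSeq hA)]
  rfl

/-- The exponential density cancels e^z, so the position of a ring inside its cell drops out of all
weights. -/
theorem lintegral_expMeasure_indicator {α β C : ℝ} (hα : 0 ≤ α) (hC : 0 ≤ C) :
    ∫⁻ z, (Set.Ioc α β).indicator (fun z => ENNReal.ofReal (C * Real.exp z)) z ∂expMeasure 1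
      = ENNReal.ofReal (C * (β - α)) := by
  have hm : Measurable ((Set.Ioc α β).indicator fun z => ENNReal.ofReal (C * Real.exp z)) :=
    Measurable.indicator (by fun_prop) measurableSet_Ioc
  have hd : Measurable (exponentialPDF 1) := (measurable_exponentialPDFReal 1).ennreal_ofReal
  have : expMeasure 1 = volume.withDensity (exponentialPDF 1) := rfl
  rw [this, lintegral_withDensity_eq_lintegral_mul _ hd hm]
  have heq : (exponentialPDF 1 * (Set.Ioc α β).indicator fun z => ENNReal.ofReal (C * Real.exp z))
      = (Set.Ioc α β).indicator fun _ => ENNReal.ofReal C := by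
    funext z
    simp only [Pi.mul_apply, Set.indicator]
    split_ifs with hz
    · rw [exponentialPDF_of_nonneg (hα.trans hz.1.le), ← ENNReal.ofReal_mul (by positivity)]
      congr 1
      rw [one_mul, one_mul, mul_left_comm, ← Real.exp_add]
      simp
    · simp
  rw [heq, lintegral_indicator measurableSet_Ioc, setLIntegral_const, Real.volume_Ioc,
    ← ENNReal.ofReal_mul hC]

theorem expMeasure_Ioi {α : ℝ} (hα : 0 ≤ α) :
    expMeasure 1 (Set.Ioi α) = ENNReal.ofReal (Real.exp (-α)) := by
  have : IsProbabilityMeasure (expMeasure 1) := isProbabilityMeasure_expMeasure one_pos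
  have h := cdf_expMeasure_eq one_pos α
  rw [cdf_eq_real, if_pos hα, one_mul] at h
  have h2 : (expMeasure 1).real (Set.Ioi α) = Real.exp (-α) := by
    rw [← Set.compl_Iic, probReal_compl_eq_one_sub measurableSet_Iic, h]
    ring
  rw [← h2, ofReal_measureReal]

theorem stepLaw_fst {A : Set ℝ} : stepLaw {z | z.1 ∈ A} = expMeasure 1 A := by
  have : {z : ℝ × ZMod 2 | z.1 ∈ A} = A ×ˢ Set.univ := by ext; simp
  rw [this, stepLaw, Measure.prod_prod]
  simp

theorem uniform_bit (b : ZMod 2) : (PMF.uniformOfFintype (ZMod 2)).toMeasure {b} = 2⁻¹ := by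
  rw [PMF.toMeasure_apply_singleton _ _ (measurableSet_singleton b)]
  simp

theorem lintegral_stepLaw {α β C : ℝ} (hα : 0 ≤ α) (hC : 0 ≤ C) (b : ZMod 2) :
    ∫⁻ z, {z : ℝ × ZMod 2 | z.1 ∈ Set.Ioc α β ∧ z.2 = b}.indicator
      (fun z => ENNReal.ofReal (C * Real.exp z.1)) z ∂stepLaw
      = ENNReal.ofReal (C * ((β - α) / 2)) := by
  have : IsProbabilityMeasure (expMeasure 1) := isProbabilityMeasure_expMeasure one_pos
  have h : ∀ z : ℝ × ZMod 2, {z : ℝ × ZMod 2 | z.1 ∈ Set.Ioc α β ∧ z.2 = b}.indicator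
      (fun z => ENNReal.ofReal (C * Real.exp z.1)) z
      = (Set.Ioc α β).indicator (fun z => ENNReal.ofReal (C * Real.exp z)) z.1
        * ({b} : Set (ZMod 2)).indicator 1 z.2 := by
    intro z
    simp only [Set.indicator, Set.mem_ofPred_eq, Set.mem_singleton_iff, Pi.one_apply]
    by_cases h1 : z.1 ∈ Set.Ioc α β <;> by_cases h2 : z.2 = b <;> simp [h1, h2]
  simp only [h]
  rw [stepLaw, lintegral_prod_mul
    (Measurable.indicator (by fun_prop) measurableSet_Ioc).aemeasurable
    ((measurable_one.indicator (measurableSet_singleton b)).aemeasurable),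
    lintegral_expMeasure_indicator hα hC, lintegral_indicator_one (measurableSet_singleton b),
    uniform_bit, mul_div_assoc', ENNReal.ofReal_div_of_pos (by norm_num)]
  simp [div_eq_mul_inv]

/-! ### The rings of a row in the cells of a grid -/

/-- The time of the ring of index `j`. -/
def seqRing (w : ℕ → ℝ × ZMod 2) (j : ℕ) : ℝ := ∑ l ∈ Finset.range (j + 1), (w l).1

/-- The last ring before the cell `c` having occurred at time `s`, the outcomes of the next `N`
cells are given by `o`: no ring in the cell `c`, or a single ring with the bit `b`. -/
def CellPath (h : ℝ) (o : ℕ → Option (ZMod 2)) : ℕ → ℕ → ℝ → (ℕ → ℝ × ZMod 2) → Prop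
  | 0, c, s, w => c * h < s + (w 0).1
  | N + 1, c, s, w =>
    match o c with
    | none => CellPath h o N (c + 1) s w
    | some b => (c * h < s + (w 0).1 ∧ s + (w 0).1 ≤ (c + 1) * h) ∧ (w 0).2 = b ∧
        CellPath h o N (c + 1) (s + (w 0).1) (fun j => w (j + 1))

theorem measurableSet_cellPath (h : ℝ) (o : ℕ → Option (ZMod 2)) (N c : ℕ) :
    MeasurableSet {p : ℝ × (ℕ → ℝ × ZMod 2) | CellPath h o N c p.1 p.2} := by
  have hm : Measurable fun p : ℝ × (ℕ → ℝ × ZMod 2) => p.1 + (p.2 0).1 := by fun_prop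
  induction N generalizing c with
  | zero => exact measurableSet_lt measurable_const hm
  | succ N ih =>
    simp only [CellPath]
    cases o c with
    | none => exact ih (c + 1)
    | some b =>
      refine MeasurableSet.inter ((measurableSet_lt measurable_const hm).inter
        (measurableSet_le hm measurable_const)) (MeasurableSet.inter ?_ ?_)
      · have hb : Measurable fun p : ℝ × (ℕ → ℝ × ZMod 2) => (p.2 0).2 := by fun_prop
        exact hb (measurableSet_singleton b)
      · exact (show Measurable fun p : ℝ × (ℕ → ℝ × ZMod 2) =>
          (p.1 + (p.2 0).1, fun j => p.2 (j + 1)) by fun_prop) (ih (c + 1))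

/-- The weight of the outcome of a cell for one row. -/
noncomputable def bitWeight (h : ℝ) : Option (ZMod 2) → ℝ
  | none => 1
  | some _ => h / 2

/-- Induction on the cells, integrating out the next waiting time at each ring. The remaining
probability depends on the ring time only through an exponential, which cancels the density; a ring
with a given bit contributes h / 2. -/
theorem rowLaw_cellPath {h : ℝ} (hh : 0 ≤ h) (o : ℕ → Option (ZMod 2)) (N c : ℕ) {s : ℝ}
    (hs : s ≤ c * h) :
    rowLaw {w | CellPath h o N c s w} = ENNReal.ofReal (Real.exp (-((c + N) * h - s))
      * ∏ d ∈ Finset.range N, bitWeight h (o (c + d))) := by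
  induction N generalizing c s with
  | zero =>
    have hA : {w | CellPath h o 0 c s w} = Function.eval 0 ⁻¹' {z | z.1 ∈ Set.Ioi (c * h - s)} := by
      ext w
      simp only [CellPath, Set.mem_ofPred_eq, Set.mem_preimage, Set.mem_Ioi, Function.eval]
      constructor <;> intro h <;> linarith
    have hm : MeasurableSet {z : ℝ × ZMod 2 | z.1 ∈ Set.Ioi (c * h - s)} :=
      measurable_fst measurableSet_Ioi
    rw [hA, rowLaw, (measurePreserving_eval_infinitePi (fun _ => stepLaw) 0).measure_preimage
      hm.nullMeasurableSet, stepLaw_fst, expMeasure_Ioi (by linarith),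
      Finset.range_zero, Finset.prod_empty, mul_one, Nat.cast_zero, add_zero]
  | succ N ih =>
    have hsec : ∀ c s, MeasurableSet {w | CellPath h o N c s w} := fun c s =>
      measurable_prodMk_left (x := s) (measurableSet_cellPath h o N c)
    have hsec' : MeasurableSet {w | CellPath h o (N + 1) c s w} :=
      measurable_prodMk_left (x := s) (measurableSet_cellPath h o (N + 1) c)
    have hc : s ≤ ((c + 1 : ℕ) : ℝ) * h := by push_cast; nlinarith
    rw [Finset.prod_range_succ']
    have hcd : ∀ d, c + (d + 1) = c + 1 + d := fun d => by omega
    rw [add_zero, Finset.prod_congr rfl fun d _ => by rw [hcd d]]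
    set Q : ℝ := ∏ d ∈ Finset.range N, bitWeight h (o (c + 1 + d)) with hQ
    have hQ0 : 0 ≤ Q := by
      refine Finset.prod_nonneg fun d _ => ?_
      cases o (c + 1 + d)
      · exact zero_le_one
      · exact div_nonneg hh (by norm_num)
    cases hoc : o c with
    | none =>
      have : {w | CellPath h o (N + 1) c s w} = {w | CellPath h o N (c + 1) s w} := by
        ext w; simp only [CellPath, hoc]
      rw [this, ih (c + 1) hc]
      simp only [bitWeight, mul_one]
      congr 3
      push_cast
      ring
    | some b =>
      rw [rowLaw_apply_eq hsec']
      have hcalc : ∀ z : ℝ × ZMod 2, rowLaw {w | consSeq z w ∈ {w | CellPath h o (N + 1) c s w}}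
          = {z : ℝ × ZMod 2 | z.1 ∈ Set.Ioc (c * h - s) ((c + 1) * h - s) ∧ z.2 = b}.indicator
            (fun z => ENNReal.ofReal (Real.exp (-((c + (N + 1 : ℕ)) * h - s)) * Q
              * Real.exp z.1)) z := by
        intro z
        have hmem : ∀ w, (consSeq z w ∈ {w | CellPath h o (N + 1) c s w}) ↔
            (z.1 ∈ Set.Ioc (c * h - s) ((c + 1) * h - s) ∧ z.2 = b)
              ∧ CellPath h o N (c + 1) (s + z.1) w := by
          intro w
          simp only [Set.mem_ofPred_eq, CellPath, hoc, consSeq, Set.mem_Ioc]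
          rw [sub_lt_iff_lt_add', le_sub_iff_add_le']
          tauto
        simp only [hmem]
        by_cases hz : z.1 ∈ Set.Ioc (c * h - s) ((c + 1) * h - s) ∧ z.2 = b
        · simp only [hz, true_and, Set.indicator, Set.mem_ofPred_eq, and_self, if_true]
          rw [ih (c + 1) (by push_cast; linarith [hz.1.2])]
          congr 1
          rw [mul_right_comm, ← Real.exp_add]
          congr 2
          push_cast
          ring
        · simp only [hz, false_and, Set.indicator, Set.mem_ofPred_eq, if_false]
          exact measure_empty
      simp only [hcalc]
      rw [lintegral_stepLaw (by linarith) (by positivity)]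
      congr 1
      simp only [bitWeight]
      ring

/-! ### Reading off the rings from the outcomes -/

theorem seqRing_strictMono {w : ℕ → ℝ × ZMod 2} (hw : ∀ j, 0 < (w j).1) : StrictMono (seqRing w) :=
  strictMono_nat_of_lt_succ fun j => by
    unfold seqRing
    rw [Finset.sum_range_succ _ (j + 1)]
    linarith [hw (j + 1)]

theorem seqRing_zero (w : ℕ → ℝ × ZMod 2) : seqRing w 0 = (w 0).1 := by simp [seqRing]

theorem seqRing_succ (w : ℕ → ℝ × ZMod 2) (j : ℕ) :
    seqRing w (j + 1) = (w 0).1 + seqRing (fun j => w (j + 1)) j := by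
  unfold seqRing
  rw [Finset.sum_range_succ']
  ring

theorem CellPath.lt {h : ℝ} (hh : 0 ≤ h) {o : ℕ → Option (ZMod 2)} {N c : ℕ} {s : ℝ}
    {w : ℕ → ℝ × ZMod 2} (H : CellPath h o N c s w) : c * h < s + (w 0).1 := by
  induction N generalizing c with
  | zero => exact H
  | succ N ih =>
    simp only [CellPath] at H
    cases hoc : o c with
    | none =>
      rw [hoc] at H
      have := ih H
      push_cast at this
      nlinarith
    | some b => rw [hoc] at H; exact H.1.1

/-- The ring of index `j` occurs in the cell `d`. -/
def InCell (h : ℝ) (d : ℕ) (r : ℝ) : Prop := d * h < r ∧ r ≤ (d + 1) * h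

theorem CellPath.rings {h : ℝ} (hh : 0 ≤ h) {o : ℕ → Option (ZMod 2)} {N c : ℕ} {s : ℝ}
    {w : ℕ → ℝ × ZMod 2} (hw : ∀ j, 0 < (w j).1) (H : CellPath h o N c s w) {d : ℕ}
    (hcd : c ≤ d) (hd : d < c + N) :
    (o d = none → ∀ j, ¬ InCell h d (s + seqRing w j)) ∧
    (∀ b, o d = some b → ∃ j, InCell h d (s + seqRing w j) ∧ (w j).2 = b ∧
      ∀ j', InCell h d (s + seqRing w j') → j' = j) := by
  induction N generalizing c s w with
  | zero => omega
  | succ N ih =>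
    have hmono := (seqRing_strictMono hw).monotone
    simp only [CellPath] at H
    cases hoc : o c with
    | none =>
      rw [hoc] at H
      rcases hcd.eq_or_lt with rfl | hcd
      · refine ⟨fun _ j hj => ?_, fun b hb => by rw [hoc] at hb; exact absurd hb (by simp)⟩
        have h1 := CellPath.lt hh H
        have h2 := hmono (Nat.zero_le j)
        rw [seqRing_zero] at h2
        have h3 := hj.2
        push_cast at h1
        linarith
      · exact ih hw H hcd (by omega)
    | some b₀ =>
      rw [hoc] at H
      obtain ⟨hin, hb₀, H⟩ := H
      have hw' : ∀ j, 0 < (w (j + 1)).1 := fun j => hw (j + 1)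
      rcases hcd.eq_or_lt with rfl | hcd
      · refine ⟨fun hn => by rw [hoc] at hn; exact absurd hn (by simp), fun b hb => ?_⟩
        rw [hoc, Option.some.injEq] at hb
        refine ⟨0, by rw [seqRing_zero]; exact hin, hb₀.trans hb, fun j' hj' => ?_⟩
        by_contra hne
        obtain ⟨j, rfl⟩ := Nat.exists_eq_succ_of_ne_zero hne
        have h1 := CellPath.lt hh H
        have h2 := (seqRing_strictMono hw').monotone (Nat.zero_le j)
        rw [seqRing_zero] at h2
        have h3 := hj'.2
        rw [Nat.succ_eq_add_one, seqRing_succ] at h3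
        push_cast at h1
        linarith
      · have hIH := ih hw' H hcd (by omega)
        have h0 : ¬ InCell h d (s + seqRing w 0) := by
          rw [seqRing_zero]
          intro hj
          have h1 := hj.1
          have h2 : ((c + 1 : ℕ) : ℝ) * h ≤ d * h :=
            mul_le_mul_of_nonneg_right (by exact_mod_cast hcd) hh
          push_cast at h2
          linarith [hin.2]
        have hs : ∀ j, s + seqRing w (j + 1)
            = s + (w 0).1 + seqRing (fun j => w (j + 1)) j := by
          intro j; rw [seqRing_succ, add_assoc]
        constructor
        · rintro hn (_ | j)
          · exact h0
          · rw [hs]; exact hIH.1 hn j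
        · intro b hb
          obtain ⟨j, hj, hjb, huniq⟩ := hIH.2 b hb
          refine ⟨j + 1, by rw [hs]; exact hj, hjb, ?_⟩
          rintro (_ | j') hj'
          · exact absurd hj' h0
          · rw [hs] at hj'
            rw [huniq j' hj']

end MatrixWalk
namespace MatrixWalk

/-! ### Almost sure properties of the noise -/

/-- The waiting times are positive, and each clock rings finitely many times in finite time. -/
def Regular {n : ℕ} (ω : Noise n) : Prop :=
  (∀ p, 0 < (ω p).1) ∧ ∀ x t, {j | ring ω x j ≤ t}.Finite

theorem map_curry_noiseLaw (n : ℕ) :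
    (noiseLaw n).map (fun ω (x : Fin n) (j : ℕ) => ω (x, j)) = Measure.pi fun _ => rowLaw := by
  rw [← Measure.infinitePi_eq_pi]
  exact Measure.infinitePi_map_curry (ι := Fin n) (κ := ℕ) fun _ _ => stepLaw

theorem measurePreserving_row {n : ℕ} (x : Fin n) :
    MeasurePreserving (fun (ω : Noise n) (j : ℕ) => ω (x, j)) (noiseLaw n) rowLaw := by
  have h1 : MeasurePreserving (fun (ω : Noise n) (x : Fin n) (j : ℕ) => ω (x, j)) (noiseLaw n)
      (Measure.pi fun _ => rowLaw) := ⟨by fun_prop, map_curry_noiseLaw n⟩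
  exact (measurePreserving_eval (fun _ : Fin n => rowLaw) x).comp h1

theorem ae_stepLaw_pos : ∀ᵐ z ∂stepLaw, 0 < z.1 := by
  have h : stepLaw {z | z.1 ∈ Set.Ioi (0 : ℝ)} = 1 := by
    rw [stepLaw_fst, expMeasure_Ioi le_rfl]; simp
  exact (prob_compl_eq_zero_iff (measurable_fst measurableSet_Ioi)).2 h

/-- The second Borel–Cantelli lemma. Infinitely many waiting times above 1 rule out explosion of the
clock. -/
theorem ae_frequently_one_lt : ∀ᵐ w ∂rowLaw, ∃ᶠ j in Filter.atTop, 1 < (w j).1 := by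
  set A : ℕ → Set (ℕ → ℝ × ZMod 2) := fun j => Function.eval j ⁻¹' {z | z.1 ∈ Set.Ioi (1 : ℝ)}
  have hm : MeasurableSet {z : ℝ × ZMod 2 | z.1 ∈ Set.Ioi (1 : ℝ)} :=
    measurable_fst measurableSet_Ioi
  have hA : ∀ j, MeasurableSet (A j) := fun j => measurable_pi_apply j hm
  have hP : ∀ j, rowLaw (A j) = stepLaw {z | z.1 ∈ Set.Ioi (1 : ℝ)} := fun j =>
    (measurePreserving_eval_infinitePi (fun _ => stepLaw) j).measure_preimage hm.nullMeasurableSet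
  have hind : iIndepSet A rowLaw := by
    rw [iIndepSet_iff_meas_biInter hA]
    intro s
    have : (⋂ j ∈ s, A j) = (s : Set ℕ).pi fun _ => {z | z.1 ∈ Set.Ioi (1 : ℝ)} := by
      ext w; simp [A]
    rw [this, rowLaw, Measure.infinitePi_pi _ fun _ _ => hm]
    exact (Finset.prod_congr rfl fun j _ => hP j).symm
  have hsum : ∑' j, rowLaw (A j) = ⊤ := by
    simp only [hP, stepLaw_fst, expMeasure_Ioi zero_le_one]
    rw [ENNReal.tsum_const_eq_top_of_ne_zero]
    simp [Real.exp_pos]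
  have h1 := measure_limsup_eq_one hA hind hsum
  have h2 : ∀ᵐ w ∂rowLaw, w ∈ Filter.limsup A Filter.atTop :=
    (prob_compl_eq_zero_iff (MeasurableSet.measurableSet_limsup hA)).2 h1
  filter_upwards [h2] with w hw
  rw [Filter.mem_limsup_iff_frequently_mem] at hw
  exact hw

theorem finite_seqRing_le {w : ℕ → ℝ × ZMod 2} (hw : ∀ j, 0 < (w j).1)
    (hf : ∃ᶠ j in Filter.atTop, 1 < (w j).1) (t : ℝ) : {j | seqRing w j ≤ t}.Finite := by
  by_contra hinf
  have hmono := (seqRing_strictMono hw).monotone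
  have hall : ∀ j, seqRing w j ≤ t := by
    intro j
    obtain ⟨j', hj', hlt⟩ := Set.Infinite.exists_gt hinf j
    exact (hmono hlt.le).trans hj'
  have hI : {j | 1 < (w j).1}.Infinite := Nat.frequently_atTop_iff_infinite.1 hf
  obtain ⟨K, hK⟩ := exists_nat_gt t
  obtain ⟨S, hS, hcard⟩ := hI.exists_subset_card_eq K
  have h1 : (K : ℝ) ≤ ∑ l ∈ S, (w l).1 := by
    have := Finset.card_nsmul_le_sum S (fun l => (w l).1) 1 fun l hl => (hS hl).le
    rwa [hcard, nsmul_eq_mul, mul_one] at this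
  have h2 : ∑ l ∈ S, (w l).1 ≤ seqRing w (S.sup id) :=
    Finset.sum_le_sum_of_subset_of_nonneg
      (fun l hl => Finset.mem_range.2 (Nat.lt_succ_of_le (Finset.le_sup (f := id) hl)))
      fun l _ _ => (hw l).le
  linarith [hall (S.sup id)]

theorem ae_regular (n : ℕ) : ∀ᵐ ω ∂noiseLaw n, Regular ω := by
  have h1 : ∀ᵐ ω ∂noiseLaw n, ∀ p, 0 < (ω p).1 :=
    ae_all_iff.2 fun p =>
      (measurePreserving_eval_infinitePi (fun _ => stepLaw) p).quasiMeasurePreserving.ae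
        ae_stepLaw_pos
  have h2 : ∀ᵐ ω ∂noiseLaw n, ∀ x : Fin n, ∃ᶠ j in Filter.atTop, 1 < (ω (x, j)).1 :=
    ae_all_iff.2 fun x => (measurePreserving_row x).quasiMeasurePreserving.ae ae_frequently_one_lt
  filter_upwards [h1, h2] with ω hω1 hω2
  exact ⟨hω1, fun x t => finite_seqRing_le (fun j => hω1 (x, j)) (hω2 x) t⟩

/-! ### Joint outcomes of several rows -/

/-- The outcome for the row `y`. -/
def rowOutcome {x : ℕ} (o : ℕ → Option (Fin x × ZMod 2)) (y c : ℕ) : Option (ZMod 2) :=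
  match o c with
  | none => none
  | some (y', b) => if y'.val = y then some b else none

/-- The rings of the rows below `x` in the first `N` cells of length `h` are given by `o`. -/
def PathEvent {n x : ℕ} (h : ℝ) (N : ℕ) (o : ℕ → Option (Fin x × ZMod 2)) (ω : Noise n) : Prop :=
  ∀ y : Fin n, y.val < x → CellPath h (rowOutcome o y) N 0 0 fun j => ω (y, j)

theorem measurableSet_cellPath_row (h : ℝ) (o : ℕ → Option (ZMod 2)) (N : ℕ) :
    MeasurableSet {w | CellPath h o N 0 0 w} :=
  measurable_prodMk_left (x := (0 : ℝ)) (measurableSet_cellPath h o N 0)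

theorem measurableSet_pathEvent {n x : ℕ} (h : ℝ) (N : ℕ) (o : ℕ → Option (Fin x × ZMod 2)) :
    MeasurableSet {ω : Noise n | PathEvent h N o ω} := by
  simp only [PathEvent, Set.ofPred_forall]
  refine MeasurableSet.iInter fun y => MeasurableSet.iInter fun _ => ?_
  exact (show Measurable fun (ω : Noise n) (j : ℕ) => ω (y, j) by fun_prop)
    (measurableSet_cellPath_row h _ N)

/-- Independence of the rows: each quiet row contributes e^{-h} per cell and the ringing one an
extra h / 2. The value `r` is a dummy, since `cellWeight` only asks whether row x is quiet. -/
theorem noiseLaw_pathEvent {n x : ℕ} (hx : x ≤ n) {h : ℝ} (hh : 0 ≤ h) (N : ℕ)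
    (o : ℕ → Option (Fin x × ZMod 2)) {V : Type*} (r : V) :
    (noiseLaw n).real {ω | PathEvent h N o ω}
      = ∏ c ∈ Finset.range N, cellWeight x h (some r) (o c) := by
  set A : Fin n → Set (ℕ → ℝ × ZMod 2) := fun y =>
    if y.val < x then {w | CellPath h (rowOutcome o y) N 0 0 w} else Set.univ with hA
  have hmA : ∀ y, MeasurableSet (A y) := by
    intro y
    simp only [hA]
    split_ifs
    · exact measurableSet_cellPath_row h _ N
    · exact MeasurableSet.univ
  have hset : {ω : Noise n | PathEvent h N o ω}
      = (fun (ω : Noise n) (x : Fin n) (j : ℕ) => ω (x, j)) ⁻¹' Set.univ.pi A := by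
    ext ω
    simp only [PathEvent, Set.mem_ofPred_eq, Set.mem_preimage, Set.mem_pi, Set.mem_univ,
      true_imp_iff, hA]
    refine forall_congr' fun y => ?_
    by_cases hy : y.val < x <;> simp [hy]
  have hbw : ∀ v, 0 ≤ bitWeight h v := by
    rintro (_ | b)
    · exact zero_le_one
    · exact div_nonneg hh (by norm_num)
  have hval : ∀ y, rowLaw (A y) = ENNReal.ofReal (if y.val < x then
      ∏ c ∈ Finset.range N, Real.exp (-h) * bitWeight h (rowOutcome o y c) else 1) := by
    intro y
    simp only [hA]
    split_ifs with hy
    · rw [rowLaw_cellPath hh _ N 0 (by simp), Finset.prod_mul_distrib, Finset.prod_const,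
        Finset.card_range, ← Real.exp_nat_mul]
      simp
    · simp
  have hprod : (noiseLaw n).real {ω | PathEvent h N o ω} = ∏ y : Fin n, if y.val < x then
      ∏ c ∈ Finset.range N, Real.exp (-h) * bitWeight h (rowOutcome o y c) else 1 := by
    rw [measureReal_def, hset, ← Measure.map_apply (by fun_prop)
      (MeasurableSet.univ_pi hmA), map_curry_noiseLaw, Measure.pi_pi, ENNReal.toReal_prod]
    refine Finset.prod_congr rfl fun y _ => ?_
    rw [hval, ENNReal.toReal_ofReal]
    split_ifs
    · exact Finset.prod_nonneg fun c _ => mul_nonneg (Real.exp_pos _).le (hbw _)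
    · exact zero_le_one
  have hfin : ∀ φ : ℕ → ℝ, ∏ y : Fin n, (if y.val < x then φ y else 1) = ∏ y : Fin x, φ y := by
    intro φ
    rw [← Finset.prod_range fun y => if y < x then φ y else 1, ← Finset.prod_range φ,
      ← Finset.prod_subset (Finset.range_subset_range.2 hx)]
    · exact Finset.prod_congr rfl fun y hy => if_pos (Finset.mem_range.1 hy)
    · intro y _ hy
      exact if_neg fun h => hy (Finset.mem_range.2 h)
  rw [hprod, hfin fun y => ∏ c ∈ Finset.range N, Real.exp (-h) * bitWeight h (rowOutcome o y c),
    Finset.prod_comm]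
  refine Finset.prod_congr rfl fun c _ => ?_
  rw [Finset.prod_mul_distrib, Finset.prod_const, Finset.card_univ, Fintype.card_fin,
    ← Real.exp_nat_mul]
  cases hoc : o c with
  | none => simp [rowOutcome, hoc, bitWeight, cellWeight]
  | some v =>
    obtain ⟨y', b⟩ := v
    simp only [rowOutcome, hoc, cellWeight, Option.isSome_some, if_true]
    congr 1
    · congr 1; ring
    · rw [Finset.prod_eq_single y']
      · simp [bitWeight]
      · intro y _ hy
        rw [if_neg fun h => hy (Fin.ext h.symm)]
        rfl
      · simp

theorem ring_eq_seqRing {n : ℕ} (ω : Noise n) (x : Fin n) (j : ℕ) :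
    ring ω x j = seqRing (fun j => ω (x, j)) j := rfl

/-- What an outcome says about the rings in one cell. -/
theorem PathEvent.rings {n x : ℕ} {h : ℝ} (hh : 0 ≤ h) {N : ℕ} {o : ℕ → Option (Fin x × ZMod 2)}
    {ω : Noise n} (hω : ∀ p, 0 < (ω p).1) (H : PathEvent h N o ω) {c : ℕ} (hc : c < N) {y : Fin n}
    (hy : y.val < x) :
    (∀ b, o c = some (⟨y, hy⟩, b) → ∃ j, InCell h c (ring ω y j) ∧ (ω (y, j)).2 = b ∧
      ∀ j', InCell h c (ring ω y j') → j' = j) ∧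
    ((∀ b, o c ≠ some (⟨y, hy⟩, b)) → ∀ j, ¬ InCell h c (ring ω y j)) := by
  have h1 := CellPath.rings hh (fun j => hω (y, j)) (H y hy) (Nat.zero_le c) (by omega)
  simp only [zero_add, ← ring_eq_seqRing] at h1
  refine ⟨fun b hb => h1.2 b (by simp [rowOutcome, hb]), fun hne => h1.1 ?_⟩
  unfold rowOutcome
  cases hoc : o c with
  | none => rfl
  | some v =>
    obtain ⟨y', b⟩ := v
    refine if_neg fun hyy => hne b ?_
    rw [hoc]
    congr 2
    exact Fin.ext hyy

theorem PathEvent.unique {n x : ℕ} (hx : x ≤ n) {h : ℝ} (hh : 0 ≤ h) {N : ℕ}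
    {o o' : ℕ → Option (Fin x × ZMod 2)} {ω : Noise n} (hω : ∀ p, 0 < (ω p).1)
    (H : PathEvent h N o ω) (H' : PathEvent h N o' ω) {c : ℕ} (hc : c < N) : o c = o' c := by
  have key : ∀ {o o' : ℕ → Option (Fin x × ZMod 2)}, PathEvent h N o ω → PathEvent h N o' ω →
      ∀ v, o c = some v → o' c = some v := by
    rintro o o' H H' ⟨y, b⟩ hv
    obtain ⟨j, hj, hjb, -⟩ := (H.rings hh hω hc (y := ⟨y, by omega⟩) y.2).1 b hv
    have h' := H'.rings hh hω hc (y := ⟨y, by omega⟩) y.2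
    by_cases hne : ∀ b, o' c ≠ some (⟨y, y.2⟩, b)
    · exact absurd hj (h'.2 hne j)
    · push Not at hne
      obtain ⟨b', hb'⟩ := hne
      obtain ⟨j', -, hjb', hu⟩ := h'.1 b' hb'
      rw [hb', ← hjb', ← hu j hj, hjb]
  cases hv : o c with
  | some v => exact (key H H' v hv).symm
  | none =>
    cases hv' : o' c with
    | none => rfl
    | some v => rw [key H' H v hv'] at hv; exact absurd hv (by simp)

/-! ### Resampling the noise of the rows below a given one -/

/-- The noise `ω'` in the rows below `x`, and `ω` in the other rows. -/
def mergeNoise {n : ℕ} (x : ℕ) (ω' ω : Noise n) : Noise n :=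
  fun p => if p.1.val < x then ω' p else ω p

theorem measurable_mergeNoise {n : ℕ} (x : ℕ) :
    Measurable fun p : Noise n × Noise n => mergeNoise x p.1 p.2 := by
  refine measurable_pi_lambda _ fun q => ?_
  unfold mergeNoise
  split_ifs <;> fun_prop

theorem map_mergeNoise {n : ℕ} (x : ℕ) :
    ((noiseLaw n).prod (noiseLaw n)).map (fun p => mergeNoise x p.1 p.2) = noiseLaw n := by
  classical
  refine Measure.eq_infinitePi _ fun s t ht => ?_
  have hpre : (fun p : Noise n × Noise n => mergeNoise x p.1 p.2) ⁻¹' ((s : Set _).pi t)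
      = (((s.filter fun q => q.1.val < x) : Finset _) : Set (Fin n × ℕ)).pi t
        ×ˢ (((s.filter fun q => ¬ q.1.val < x) : Finset _) : Set (Fin n × ℕ)).pi t := by
    ext ⟨ω', ω⟩
    simp only [Set.mem_preimage, Set.mem_pi, Finset.mem_coe, Set.mem_prod, Finset.mem_filter,
      mergeNoise]
    constructor
    · intro H
      exact ⟨fun q hq => by simpa [hq.2] using H q hq.1, fun q hq => by simpa [hq.2] using H q hq.1⟩
    · intro H q hq
      split_ifs with hqx
      · exact H.1 q ⟨hq, hqx⟩
      · exact H.2 q ⟨hq, hqx⟩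
  rw [Measure.map_apply (measurable_mergeNoise x)
    (MeasurableSet.pi (Finset.countable_toSet _) fun j _ => ht j), hpre, Measure.prod_prod,
    noiseLaw, Measure.infinitePi_pi _ fun j _ => ht j, Measure.infinitePi_pi _ fun j _ => ht j,
    Finset.prod_filter_mul_prod_filter_not]

theorem measurePreserving_mergeNoise {n : ℕ} (x : ℕ) :
    MeasurePreserving (fun p : Noise n × Noise n => mergeNoise x p.1 p.2)
      ((noiseLaw n).prod (noiseLaw n)) (noiseLaw n) :=
  ⟨measurable_mergeNoise x, map_mergeNoise x⟩

end MatrixWalk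
namespace MatrixWalk

/-! ### Path properties of the walk -/

section Paths

variable {n : ℕ} (M : Matrix (Fin n) (Fin n) (ZMod 2))

theorem walkRow_of_lt (ω : Noise n) {x : Fin n} (hx : x.val + 1 < n) (t : ℝ) :
    walkRow M ω x t = M x + ∑ᶠ j ∈ {j | ring ω x j ≤ t},
      (ω (x, j)).2 • walkRow M ω ⟨x.val + 1, hx⟩ (ring ω x j) := by
  rw [walkRow, dif_pos hx]
  rfl

theorem walkRow_of_not_lt (ω : Noise n) {x : Fin n} (hx : ¬ x.val + 1 < n) (t : ℝ) :
    walkRow M ω x t = M x := by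
  rw [walkRow, dif_neg hx]

theorem walkRow_congr {ω ω' : Noise n} {x : Fin n} (h : ∀ y, x ≤ y → ∀ j, ω (y, j) = ω' (y, j))
    (t : ℝ) : walkRow M ω x t = walkRow M ω' x t := by
  induction hm : n - x.val using Nat.strong_induction_on generalizing x t with
  | _ m ih =>
    by_cases hx : x.val + 1 < n
    · rw [walkRow_of_lt M ω hx, walkRow_of_lt M ω' hx]
      have hr : ∀ j, ring ω x j = ring ω' x j := fun j =>
        Finset.sum_congr rfl fun l _ => by rw [h x le_rfl l]
      have hw : ∀ s, walkRow M ω ⟨x.val + 1, hx⟩ s = walkRow M ω' ⟨x.val + 1, hx⟩ s := fun s =>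
        ih (n - (x.val + 1)) (by omega) (x := ⟨x.val + 1, hx⟩)
          (fun y hy j => h y (le_trans (Fin.le_def.2 (by simp)) hy) j) s rfl
      simp only [hr, hw, h x le_rfl]
    · rw [walkRow_of_not_lt M ω hx, walkRow_of_not_lt M ω' hx]

theorem walkRow_eq_of_no_ring {ω : Noise n} {x : Fin n} {s s' : ℝ} (hs : s ≤ s')
    (h : ∀ j, ¬ (s < ring ω x j ∧ ring ω x j ≤ s')) : walkRow M ω x s' = walkRow M ω x s := by
  by_cases hx : x.val + 1 < n
  · have : {j | ring ω x j ≤ s'} = {j | ring ω x j ≤ s} := by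
      ext j
      have := h j
      simp only [Set.mem_ofPred_eq]
      constructor
      · intro hj
        by_contra hj'
        exact this ⟨not_le.1 hj', hj⟩
      · exact fun hj => hj.trans hs
    rw [walkRow_of_lt M ω hx, walkRow_of_lt M ω hx, this]
  · rw [walkRow_of_not_lt M ω hx, walkRow_of_not_lt M ω hx]

theorem walkRow_eq_of_ring {ω : Noise n} (hω : Regular ω) {x : Fin n} (hx : x.val + 1 < n)
    {s s' : ℝ} {j : ℕ} (hj : s < ring ω x j ∧ ring ω x j ≤ s')
    (h : ∀ j', (s < ring ω x j' ∧ ring ω x j' ≤ s') → j' = j) :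
    walkRow M ω x s' = walkRow M ω x s
      + (ω (x, j)).2 • walkRow M ω ⟨x.val + 1, hx⟩ (ring ω x j) := by
  have hset : {j | ring ω x j ≤ s'} = insert j {j | ring ω x j ≤ s} := by
    ext j'
    simp only [Set.mem_ofPred_eq, Set.mem_insert_iff]
    constructor
    · intro hj'
      by_cases hs : ring ω x j' ≤ s
      · exact Or.inr hs
      · exact Or.inl (h j' ⟨not_le.1 hs, hj'⟩)
    · rintro (rfl | hj')
      · exact hj.2
      · exact hj'.trans (hj.1.le.trans hj.2)
  rw [walkRow_of_lt M ω hx, walkRow_of_lt M ω hx, hset,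
    finsum_mem_insert _ (by simpa using hj.1) (hω.2 x s), add_assoc, add_comm (_ • _)]

theorem ring_pos {ω : Noise n} (hω : Regular ω) (x : Fin n) (j : ℕ) : 0 < ring ω x j :=
  Finset.sum_pos (fun l _ => hω.1 (x, l)) (by simp)

theorem walkRow_time_zero {ω : Noise n} (hω : Regular ω) (x : Fin n) :
    walkRow M ω x 0 = M x := by
  by_cases hx : x.val + 1 < n
  · have : {j | ring ω x j ≤ 0} = ∅ := by
      ext j; simpa using ring_pos hω x j
    rw [walkRow_of_lt M ω hx, this]
    simp
  · exact walkRow_of_not_lt M ω hx 0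

/-! ### The walk on the grid -/

variable {k : ℕ} (i : Fin k → Fin n)

/-- The chosen columns, as a sequence of rows. -/
def rowsOf (r : ℕ) : Fin k → ZMod 2 := fun j => if hr : r < n then M ⟨r, hr⟩ (i j) else 0

open Classical in
/-- The chosen entries of row `x` during the cell `c`, if the clock of the row does not ring. -/
noncomputable def cellValue (ω : Noise n) (x : Fin n) (h : ℝ) (c : ℕ) : Option (Fin k → ZMod 2) :=
  if ∃ j, InCell h c (ring ω x j) then none else some fun j => walkRow M ω x (c * h) (i j)

/-- If only row y rings in a cell, row y + 1 is constant there, so the value added at the ring is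
the one at the start of the cell. The hypothesis `ho` covers y + 1 = x, where row x must be quiet.
-/
theorem walkRow_eq_gridMap {ω : Noise n} (hω : Regular ω) (x : Fin n) {h : ℝ} (hh : 0 ≤ h) {N : ℕ}
    {o : ℕ → Option (Fin x × ZMod 2)} (H : PathEvent h N o ω)
    (ho : ∀ c < N, cellValue M i ω x h c = none → o c = none) {c : ℕ} (hc : c ≤ N) {y : Fin n}
    (hy : y < x) :
    (fun j => walkRow M ω y (c * h) (i j))
      = gridMap x (cellValue M i ω x h) o (rowsOf M i) c y := by
  induction c generalizing y with
  | zero =>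
    funext j
    simp [gridMap, rowsOf, walkRow_time_zero M hω]
  | succ c ih =>
    have hcN : c < N := hc
    have hle : (c : ℝ) * h ≤ ((c + 1 : ℕ) : ℝ) * h := by push_cast; nlinarith
    have hcast : ((c + 1 : ℕ) : ℝ) * h = (c + 1) * h := by push_cast; ring
    have hyx : y.val < x.val := hy
    have hR := H.rings hh hω.1 hcN (y := y) hyx
    have hy1 : y.val + 1 < n := by omega
    by_cases hone : ∃ b, o c = some (⟨y, hyx⟩, b)
    · obtain ⟨b, hb⟩ := hone
      obtain ⟨j, hj, hjb, hu⟩ := hR.1 b hb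
      have hρ : cellValue M i ω x h c ≠ none := fun hn => by
        rw [ho c hcN hn] at hb; exact absurd hb (by simp)
      have hnoring : ∀ j', ¬ InCell h c (ring ω ⟨y.val + 1, hy1⟩ j') := by
        by_cases hyx1 : y.val + 1 = x
        · intro j' hj'
          refine hρ (if_pos ⟨j', ?_⟩)
          have : (⟨y.val + 1, hy1⟩ : Fin n) = x := Fin.ext hyx1
          rwa [this] at hj'
        · refine (H.rings hh hω.1 hcN (y := ⟨y.val + 1, hy1⟩) (by simp only; omega)).2 ?_
          intro b' hb'
          rw [hb] at hb'
          simp only [Option.some.injEq, Prod.mk.injEq, Fin.mk.injEq] at hb'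
          omega
      have hconst : walkRow M ω ⟨y.val + 1, hy1⟩ (ring ω y j)
          = walkRow M ω ⟨y.val + 1, hy1⟩ (c * h) :=
        walkRow_eq_of_no_ring M hj.1.le fun j' hj' => hnoring j' ⟨hj'.1, hj'.2.trans hj.2⟩
      have hstep := walkRow_eq_of_ring M hω hy1 (s := c * h) (s' := ((c + 1 : ℕ) : ℝ) * h)
        (j := j) (by rw [hcast]; exact hj) (by rw [hcast]; exact hu)
      rw [hconst, hjb] at hstep
      rw [gridMap, hb, cellMap, rowOp]
      simp only [Function.update_self]
      rw [← ih hcN.le hy, hstep]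
      funext j'
      simp only [Pi.add_apply, Pi.smul_apply]
      congr 2
      split_ifs with hyx1
      · have hxy : (⟨y.val + 1, hy1⟩ : Fin n) = x := Fin.ext hyx1
        unfold cellValue at hρ ⊢
        split_ifs at hρ ⊢
        · simp only [ne_eq, not_true] at hρ
        · rw [hxy]; rfl
      · have := ih hcN.le (y := ⟨y.val + 1, hy1⟩) (Fin.lt_def.2 (by simp only; omega))
        rw [← this]
    · push Not at hone
      have hno := hR.2 hone
      rw [walkRow_eq_of_no_ring M hle fun j => by rw [hcast]; exact hno j, ih hcN.le hy, gridMap]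
      cases hoc : o c with
      | none => rfl
      | some v =>
        obtain ⟨y', b⟩ := v
        rw [cellMap, rowOp, Function.update_of_ne]
        intro hyy
        refine hone b ?_
        rw [hoc]
        congr 2
        exact Fin.ext hyy.symm

/-! ### Measurability of the walk -/

/-- A finite sum over infinitely many indices is an eventually constant limit of truncations. The
truncation is set to 0 while nonzero terms remain, which matches the default value 0 of `∑ᶠ` for
infinite support. -/
theorem measurable_finsum_of_countable {α W : Type*} [MeasurableSpace α] [AddCommMonoid W]
    [MeasurableSpace W] [Countable W] [MeasurableSingletonClass W] {φ : ℕ → α → W}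
    (hφ : ∀ j, Measurable (φ j)) : Measurable fun a => ∑ᶠ j, φ j a := by
  classical
  have : MeasurableAdd₂ W := ⟨Measurable.of_discrete⟩
  set G : ℕ → α → W := fun J a => if ∀ j, J ≤ j → φ j a = 0 then ∑ j ∈ Finset.range J, φ j a else 0
    with hG
  have hGm : ∀ J, Measurable (G J) := by
    intro J
    refine Measurable.ite ?_ (Finset.measurable_sum _ fun j _ => hφ j) measurable_const
    simp only [Set.ofPred_forall]
    exact MeasurableSet.iInter fun j => MeasurableSet.iInter fun _ =>
      hφ j (measurableSet_singleton 0)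
  have hev : ∀ a, ∃ J₀, ∀ J, J₀ ≤ J → G J a = ∑ᶠ j, φ j a := by
    intro a
    by_cases hf : (Function.support fun j => φ j a).Finite
    · obtain ⟨J₀, hJ₀⟩ := hf.bddAbove
      refine ⟨J₀ + 1, fun J hJ => ?_⟩
      have hz : ∀ j, J ≤ j → φ j a = 0 := by
        intro j hj
        by_contra hne
        have := hJ₀ (show j ∈ Function.support fun j => φ j a from hne)
        omega
      simp only [hG, if_pos hz]
      refine (finsum_eq_sum_of_support_subset _ fun j hj => ?_).symm
      rw [Finset.coe_range, Set.mem_Iio]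
      by_contra hlt
      exact hj (hz j (not_lt.1 hlt))
    · refine ⟨0, fun J _ => ?_⟩
      rw [finsum_of_infinite_support hf]
      simp only [hG]
      refine if_neg fun hz => hf ((Finset.range J).finite_toSet.subset fun j hj => ?_)
      rw [Finset.coe_range, Set.mem_Iio]
      by_contra hlt
      exact hj (hz j (not_lt.1 hlt))
  refine measurable_to_countable' fun v => ?_
  have hset : (fun a => ∑ᶠ j, φ j a) ⁻¹' {v} = ⋃ J₀, ⋂ J, ⋂ (_ : J₀ ≤ J), G J ⁻¹' {v} := by
    ext a
    obtain ⟨J₀, hJ₀⟩ := hev a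
    simp only [Set.mem_preimage, Set.mem_singleton_iff, Set.mem_iUnion, Set.mem_iInter]
    constructor
    · exact fun h => ⟨J₀, fun J hJ => (hJ₀ J hJ).trans h⟩
    · rintro ⟨J₁, hJ₁⟩
      rw [← hJ₀ (max J₀ J₁) (le_max_left _ _), hJ₁ _ (le_max_right _ _)]
  rw [hset]
  exact MeasurableSet.iUnion fun _ => MeasurableSet.iInter fun J => MeasurableSet.iInter fun _ =>
    hGm J (measurableSet_singleton v)

theorem measurable_ring (x : Fin n) (j : ℕ) : Measurable fun ω : Noise n => ring ω x j := by
  unfold ring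
  fun_prop

theorem measurable_walkRow (x : Fin n) :
    Measurable fun p : Noise n × ℝ => walkRow M p.1 x p.2 := by
  classical
  induction hm : n - x.val using Nat.strong_induction_on generalizing x with
  | _ m ih =>
    by_cases hx : x.val + 1 < n
    · simp only [walkRow_of_lt M _ hx]
      have hadd : Measurable fun v : Fin n → ZMod 2 => M x + v := Measurable.of_discrete
      refine hadd.comp (measurable_finsum_of_countable fun j => ?_)
      simp only [Set.mem_ofPred_eq, finsum_eq_if]
      have hr : Measurable fun p : Noise n × ℝ => ring p.1 x j :=
        (measurable_ring x j).comp measurable_fst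
      refine Measurable.ite (measurableSet_le hr measurable_snd) ?_ measurable_const
      have h1 : Measurable fun p : Noise n × ℝ =>
          walkRow M p.1 ⟨x.val + 1, hx⟩ (ring p.1 x j) :=
        (ih (n - (x.val + 1)) (by omega) ⟨x.val + 1, hx⟩ rfl).comp (measurable_fst.prodMk hr)
      have h2 : Measurable fun p : Noise n × ℝ => (p.1 (x, j)).2 := by fun_prop
      have h3 : Measurable fun q : ZMod 2 × (Fin n → ZMod 2) => q.1 • q.2 := Measurable.of_discrete
      exact h3.comp (h2.prodMk h1)
    · simp only [walkRow_of_not_lt M _ hx]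
      exact measurable_const

end Paths

theorem measurable_comp_walk {n : ℕ} {β : Type*} [MeasurableSpace β] (M : UniMat n)
    (Φ : UniMat n → β) : Measurable fun p : Noise n × ℝ => Φ (walk M p.1 p.2) := by
  let _ : MeasurableSpace (UniMat n) := ⊤
  have : Measurable fun p : Noise n × ℝ => walk M p.1 p.2 := by
    refine measurable_to_countable' fun A => ?_
    have hset : (fun p : Noise n × ℝ => walk M p.1 p.2) ⁻¹' {A}
        = ⋂ x, (fun p : Noise n × ℝ => walkRow M.1 p.1 x p.2) ⁻¹' {A.1 x} := by
      ext p
      simp only [Set.mem_preimage, Set.mem_singleton_iff, Set.mem_iInter]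
      constructor
      · rintro rfl x; rfl
      · exact fun h => Subtype.ext (funext h)
    rw [hset]
    exact MeasurableSet.iInter fun x => measurable_walkRow M.1 x (measurableSet_singleton _)
  exact (show Measurable Φ from fun _ _ => trivial).comp this

open Classical in
theorem measurable_pattern {n k : ℕ} (i : Fin k → Fin n) (M : UniMat n) (r : Fin n) :
    Measurable fun p : Noise n × ℝ =>
      if Pattern (cols i (walk M p.1 p.2)) r then (1 : ℝ) else 0 :=
  measurable_comp_walk M fun A => if Pattern (cols i A) r then (1 : ℝ) else 0

theorem measurableSet_goodRow {n k : ℕ} (i : Fin k → Fin n) (M : UniMat n) (s t : ℝ) (r : Fin n) :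
    MeasurableSet {ω | GoodRow (fun u => cols i (walk M ω u)) s t r} := by
  classical
  have h := measurable_pattern i M r
  have h1 : ∀ μ : Measure ℝ, SFinite μ → Measurable fun ω : Noise n =>
      ∫ u, (if Pattern (cols i (walk M ω u)) r then (1 : ℝ) else 0) ∂μ := fun μ _ =>
    (h.stronglyMeasurable.integral_prod_right' (ν := μ)).measurable
  unfold GoodRow
  refine measurableSet_le measurable_const ?_
  simp only [intervalIntegral]
  convert! (h1 (volume.restrict (Set.Ioc s t)) inferInstance).sub
    (h1 (volume.restrict (Set.Ioc t s)) inferInstance)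

end MatrixWalk
namespace MatrixWalk

/-! ### The averaged observable as a function of the rows below `x` -/

section Observable

variable {n k : ℕ} (i : Fin k → Fin n)

/-- The row `(0, …, 0, 1)`. -/
def patternRow (k : ℕ) : Fin k → ZMod 2 := fun j => if j.val + 1 = k then 1 else 0

/-- The rows below `x` are those of `U`, the other rows those of `R`. -/
def glueRows (x : ℕ) (R : Fin n → Fin k → ZMod 2) (U : ℕ → Fin k → ZMod 2) :
    Matrix (Fin n) (Fin k) (ZMod 2) := fun r => if r.val < x then U r else R r

open Classical in
/-- The function `G`, seen as a function of the rows below `x`. -/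
noncomputable def glueFun (x : ℕ) (R : Fin n → Fin k → ZMod 2) (G : ColMat n i → ℝ)
    (U : ℕ → Fin k → ZMod 2) : ℝ :=
  if h : ∀ j, (∀ r, i j < r → glueRows x R U r j = 0) ∧ glueRows x R U (i j) j = 1 then
    G ⟨glueRows x R U, h⟩ else 0

theorem glueRows_shiftRows (x : ℕ) (R : Fin n → Fin k → ZMod 2) (U : ℕ → Fin k → ZMod 2)
    (w : Finset ℕ) (r : Fin n) (j : Fin k) :
    glueRows x R (shiftRows (patternRow k) w U) r j = glueRows x R U r j
      + if r.val < x ∧ r.val ∈ w ∧ j.val + 1 = k then 1 else 0 := by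
  unfold glueRows shiftRows patternRow
  by_cases h1 : r.val < x <;> by_cases h2 : r.val ∈ w <;> by_cases h3 : j.val + 1 = k <;>
    simp [h1, h2, h3]

variable {i}

/-- Shifts by p touch only the last column in rows below x, strictly above its diagonal entry. So
the default value 0 of `glueFun` at inadmissible matrices respects shifts. -/
theorem glueRows_valid_shiftRows {x : ℕ} (hx : ∀ j : Fin k, j.val + 1 = k → x ≤ (i j).val)
    {R : Fin n → Fin k → ZMod 2} {U : ℕ → Fin k → ZMod 2} (w : Finset ℕ)
    (h : ∀ j, (∀ r, i j < r → glueRows x R U r j = 0) ∧ glueRows x R U (i j) j = 1) :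
    ∀ j, (∀ r, i j < r → glueRows x R (shiftRows (patternRow k) w U) r j = 0)
      ∧ glueRows x R (shiftRows (patternRow k) w U) (i j) j = 1 := by
  have key : ∀ j r, i j ≤ r →
      glueRows x R (shiftRows (patternRow k) w U) r j = glueRows x R U r j := by
    intro j r hr
    rw [glueRows_shiftRows, if_neg, add_zero]
    rintro ⟨h1, -, h3⟩
    have := hx j h3
    have := Fin.le_def.1 hr
    omega
  exact fun j => ⟨fun r hr => by rw [key j r hr.le, (h j).1 r hr],
    by rw [key j _ le_rfl, (h j).2]⟩

theorem shiftRows_self {V : Type*} [AddCommGroup V] [Module (ZMod 2) V] (p : V) (w : Finset ℕ)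
    (U : ℕ → V) : shiftRows p w (shiftRows p w U) = U := by
  funext r
  simp only [shiftRows]
  split_ifs
  · rw [add_assoc, ZModModule.add_self, add_zero]
  · simp

theorem abs_glueFun_le (x : ℕ) (R : Fin n → Fin k → ZMod 2) {G : ColMat n i → ℝ} {B : ℝ}
    (hB : 0 ≤ B) (hG : ∀ A, |G A| ≤ B) (U : ℕ → Fin k → ZMod 2) : |glueFun i x R G U| ≤ B := by
  unfold glueFun
  split_ifs
  · exact hG _
  · simpa using hB

theorem glueFun_shiftRows_singleton {x : ℕ} (hx : ∀ j : Fin k, j.val + 1 = k → x ≤ (i j).val)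
    (R : Fin n → Fin k → ZMod 2) {G : ColMat n i → ℝ} {b : ℕ}
    (hG : ∀ A B, AgreeOff (lastColUpTo n k b) A B → G A = G B) {s : ℕ} (hs : s < b)
    (U : ℕ → Fin k → ZMod 2) :
    glueFun i x R G (shiftRows (patternRow k) {s} U) = glueFun i x R G U := by
  unfold glueFun
  by_cases h : ∀ j, (∀ r, i j < r → glueRows x R U r j = 0) ∧ glueRows x R U (i j) j = 1
  · rw [dif_pos h, dif_pos (glueRows_valid_shiftRows hx {s} h)]
    refine hG _ _ fun r j hrj => ?_
    change glueRows x R (shiftRows (patternRow k) {s} U) r j = glueRows x R U r j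
    rw [glueRows_shiftRows, if_neg, add_zero]
    rintro ⟨-, h2, h3⟩
    rw [Finset.mem_singleton] at h2
    exact hrj ⟨by simp only; omega, h3⟩
  · rw [dif_neg h, dif_neg fun h' => h ?_]
    have := glueRows_valid_shiftRows hx {s} h'
    rwa [shiftRows_self] at this

-- This is the vanishing of the coefficient with index ∅: the shifts by p of an admissible U run
-- bijectively through the class over which G averages to 0.
open Classical in
theorem sum_glueFun_eq_zero (hk : 1 ≤ k) {x : ℕ} (hxn : x ≤ n)
    (hx : ∀ j : Fin k, j.val + 1 = k → x ≤ (i j).val)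
    (R : Fin n → Fin k → ZMod 2) {G : ColMat n i → ℝ}
    (hG : ∀ A, ∑ B with AgreeOff (lastColUpTo n k x) A B, G B = 0)
    (U : ℕ → Fin k → ZMod 2) :
    ∑ w ∈ (Finset.range x).powerset, glueFun i x R G (shiftRows (patternRow k) w U) = 0 := by
  by_cases h : ∀ j, (∀ r, i j < r → glueRows x R U r j = 0) ∧ glueRows x R U (i j) j = 1
  · have hv := fun w => glueRows_valid_shiftRows hx w h
    set l : Fin k := ⟨k - 1, by omega⟩ with hl
    have hlk : l.val + 1 = k := by simp only [hl]; omega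
    rw [← hG ⟨_, h⟩]
    refine Finset.sum_bij (fun w _ => ⟨_, hv w⟩) ?_ ?_ ?_ ?_
    · intro w _
      refine Finset.mem_filter.2 ⟨Finset.mem_univ _, fun r j hrj => ?_⟩
      change glueRows x R U r j = glueRows x R (shiftRows (patternRow k) w U) r j
      rw [glueRows_shiftRows, if_neg, add_zero]
      rintro ⟨h1, -, h3⟩
      exact hrj ⟨h1, h3⟩
    · intro w hw w' hw' heq
      have hw := Finset.mem_powerset.1 hw
      have hw' := Finset.mem_powerset.1 hw'
      ext r
      by_cases hr : r < x
      · have h1 := congrFun (congrFun (congrArg Subtype.val heq) ⟨r, by omega⟩) l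
        simp only [glueRows_shiftRows, hr, hlk, true_and, and_true, add_right_inj] at h1
        by_cases hrw : r ∈ w <;> by_cases hrw' : r ∈ w' <;> simp [hrw, hrw'] at h1 ⊢
      · exact ⟨fun hrw => absurd (Finset.mem_range.1 (hw hrw)) hr,
          fun hrw => absurd (Finset.mem_range.1 (hw' hrw)) hr⟩
    · intro B hB
      have hB : ∀ r j, (r, j) ∉ lastColUpTo n k x → glueRows x R U r j = B.1 r j :=
        (Finset.mem_filter.1 hB).2
      refine ⟨(Finset.range x).filter fun r => ∃ hr : r < n, B.1 ⟨r, hr⟩ l ≠ glueRows x R U ⟨r, hr⟩ l,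
        Finset.mem_powerset.2 (Finset.filter_subset _ _), Subtype.ext ?_⟩
      funext r j
      change glueRows x R (shiftRows (patternRow k) _ U) r j = _
      rw [glueRows_shiftRows]
      by_cases hrj : r.val < x ∧ j.val + 1 = k
      · have hjl : j = l := Fin.ext (by omega)
        subst hjl
        simp only [hrj, Finset.mem_filter, Finset.mem_range, r.2, exists_true_left, true_and,
          and_true, Fin.eta]
        have h2 : ∀ α β : ZMod 2, α + (if β ≠ α then 1 else 0) = β := by decide
        exact h2 _ _
      · rw [if_neg fun h => hrj ⟨h.1, h.2.2⟩, add_zero]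
        exact hB r j hrj
    · intro w _
      unfold glueFun
      rw [dif_pos (hv w)]
  · refine Finset.sum_eq_zero fun w _ => ?_
    unfold glueFun
    rw [dif_neg fun h' => h ?_]
    have := glueRows_valid_shiftRows hx w h'
    rwa [shiftRows_self] at this

open Classical in
/-- The contraction estimate for the operators of the grid, applied to an observable which does not
depend on the entries of the last column in the first `b` rows, and whose average over the entries
of the last column in the rows below `x` vanishes. -/
theorem abs_gridOp_glueFun_le (hk : 1 ≤ k) {x b : ℕ} (hxn : x ≤ n) (hbx : b ≤ x)
    (hx : ∀ j : Fin k, j.val + 1 = k → x ≤ (i j).val)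
    (R : Fin n → Fin k → ZMod 2) {G : ColMat n i → ℝ} (hG2 : ∀ A, |G A| ≤ 2)
    (hGb : ∀ A B, AgreeOff (lastColUpTo n k b) A B → G A = G B)
    (hG0 : ∀ A, ∑ B with AgreeOff (lastColUpTo n k x) A B, G B = 0)
    {h : ℝ} (hh : 0 ≤ h) (ρ : ℕ → Option (Fin k → ZMod 2)) (N : ℕ) (U : ℕ → Fin k → ZMod 2) :
    |gridOp x h ρ N (glueFun i x R G) U| ≤ 2 * 2 ^ (x - b) * Real.exp (N * (x * h) ^ 2
      - ((Finset.range N).filter fun c => ρ c = some (patternRow k)).card * h / 268) := by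
  -- The initial bounds: 2 wherever a coefficient may be nonzero. Their squares sum to at most 4 · 2
  -- ^ (x - b), and Cauchy–Schwarz contributes a second factor 2 ^ (x - b) before the square root.
  set n₀ : Finset ℕ → ℝ := fun u => if u ≠ ∅ ∧ u ⊆ Finset.Ico b x then 2 else 0 with hn₀
  have hcoef : ∀ u ⊆ Finset.range x, ∀ U,
      |walshCoeff (patternRow k) x (glueFun i x R G) u U| ≤ n₀ u := by
    intro u hu U
    by_cases hu0 : u = ∅
    · subst hu0
      have : walshCoeff (patternRow k) x (glueFun i x R G) ∅ U = 0 := by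
        unfold walshCoeff
        simp only [walsh, Finset.prod_empty, one_mul]
        rw [sum_glueFun_eq_zero hk hxn hx R hG0, zero_div]
      simp [this, hn₀]
    · by_cases hub : u ⊆ Finset.Ico b x
      · simp only [hn₀]
        rw [if_pos ⟨hu0, hub⟩]
        exact abs_walshCoeff_le _ _ (abs_glueFun_le x R (by norm_num) hG2) u U
      · obtain ⟨s, hs, hsb⟩ := Finset.not_subset.1 hub
        have hsx := Finset.mem_range.1 (hu hs)
        rw [Finset.mem_Ico] at hsb
        rw [walshCoeff_eq_zero (patternRow k) hsx
          (fun U => glueFun_shiftRows_singleton hx R hGb (by omega) U) hs U]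
        simp [hn₀, hub]
  have hsq := sq_gridOp_le (patternRow k) hbx hh ρ N (f := glueFun i x R G) (n := n₀)
    (by simp [hn₀]) (fun u _ hu => by simp [hn₀, hu]) hcoef U
  have hsum : ∑ u ∈ (Finset.Ico b x).powerset, n₀ u ^ 2 ≤ 4 * 2 ^ (x - b) := by
    refine (Finset.sum_le_card_nsmul _ _ 4 fun u _ => ?_).trans (le_of_eq ?_)
    · simp only [hn₀]
      split_ifs <;> norm_num
    · simp [mul_comm]
  have hexp : ∑ c ∈ Finset.range N, (2 * (x * h) ^ 2
      - if ρ c = some (patternRow k) then h / 134 else 0)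
      = 2 * (N * (x * h) ^ 2
        - ((Finset.range N).filter fun c => ρ c = some (patternRow k)).card * h / 268) := by
    rw [Finset.sum_sub_distrib, ← Finset.sum_filter, Finset.sum_const, Finset.sum_const,
      Finset.card_range, nsmul_eq_mul, nsmul_eq_mul]
    ring
  rw [hexp] at hsq
  refine abs_le_of_sq_le_sq' ?_ (by positivity) |> abs_le.2
  refine hsq.trans ?_
  rw [two_mul (_ - _), Real.exp_add]
  calc _ ≤ 2 ^ (x - b) * (Real.exp _ * Real.exp _ * (4 * 2 ^ (x - b))) := by gcongr
    _ = _ := by ring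

end Observable

end MatrixWalk
namespace MatrixWalk

/-! ### Integrating out the noise of the rows below a given one -/

section Merge

variable {n : ℕ}

theorem mergeNoise_of_lt {x : ℕ} (ω' ω : Noise n) {y : Fin n} (hy : y.val < x) (j : ℕ) :
    mergeNoise x ω' ω (y, j) = ω' (y, j) := if_pos hy

theorem mergeNoise_of_le {x : ℕ} (ω' ω : Noise n) {y : Fin n} (hy : x ≤ y.val) (j : ℕ) :
    mergeNoise x ω' ω (y, j) = ω (y, j) := if_neg (not_lt.2 hy)

theorem ring_mergeNoise_of_lt {x : ℕ} (ω' ω : Noise n) {y : Fin n} (hy : y.val < x) (j : ℕ) :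
    ring (mergeNoise x ω' ω) y j = ring ω' y j :=
  Finset.sum_congr rfl fun l _ => by rw [mergeNoise_of_lt ω' ω hy l]

theorem ring_mergeNoise_of_le {x : ℕ} (ω' ω : Noise n) {y : Fin n} (hy : x ≤ y.val) (j : ℕ) :
    ring (mergeNoise x ω' ω) y j = ring ω y j :=
  Finset.sum_congr rfl fun l _ => by rw [mergeNoise_of_le ω' ω hy l]

theorem Regular.mergeNoise {ω' ω : Noise n} (h' : Regular ω') (h : Regular ω) (x : ℕ) :
    Regular (mergeNoise x ω' ω) := by
  refine ⟨fun p => ?_, fun y t => ?_⟩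
  · unfold MatrixWalk.mergeNoise
    split_ifs
    · exact h'.1 p
    · exact h.1 p
  · by_cases hy : y.val < x
    · simp only [ring_mergeNoise_of_lt ω' ω hy]; exact h'.2 y t
    · simp only [ring_mergeNoise_of_le ω' ω (not_lt.1 hy)]; exact h.2 y t

theorem pathEvent_mergeNoise {x : ℕ} (ω' ω : Noise n) {h : ℝ} {N : ℕ}
    {o : ℕ → Option (Fin x × ZMod 2)} :
    PathEvent h N o (mergeNoise x ω' ω) ↔ PathEvent h N o ω' := by
  unfold PathEvent
  refine forall_congr' fun y => forall_congr' fun hy => ?_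
  simp only [mergeNoise_of_lt ω' ω hy]

theorem walkRow_mergeNoise (M : Matrix (Fin n) (Fin n) (ZMod 2)) {x : ℕ} (ω' ω : Noise n)
    {y : Fin n} (hy : x ≤ y.val) (t : ℝ) :
    walkRow M (mergeNoise x ω' ω) y t = walkRow M ω y t :=
  walkRow_congr M (fun _ hz j => mergeNoise_of_le ω' ω (hy.trans (Fin.le_def.1 hz)) j) t

variable {k : ℕ} (i : Fin k → Fin n) (M : UniMat n)

theorem cellValue_mergeNoise (ω' ω : Noise n) (x : Fin n) (h : ℝ) :
    cellValue M.1 i (mergeNoise x ω' ω) x h = cellValue M.1 i ω x h := by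
  funext c
  unfold cellValue
  have e : ∀ j, ring (mergeNoise x ω' ω) x j = ring ω x j :=
    ring_mergeNoise_of_le ω' ω (le_refl x.val)
  simp only [walkRow_mergeNoise M.1 ω' ω (le_refl x.val)]
  by_cases hj : ∃ j, InCell h c (ring ω x j)
  · rw [if_pos hj, if_pos (by simpa only [e] using hj)]
  · rw [if_neg hj, if_neg (by simpa only [e] using hj)]

variable {i}

theorem glueFun_gridMap {ω' ω : Noise n} (h' : Regular ω') (hω : Regular ω) (x : Fin n) {h : ℝ}
    (hh : 0 ≤ h) {N : ℕ} {o : ℕ → Option (Fin x × ZMod 2)} (H : PathEvent h N o ω')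
    (ho : ∀ c < N, cellValue M.1 i ω x h c = none → o c = none) (G : ColMat n i → ℝ) :
    glueFun i x (fun r j => walkRow M.1 ω r (N * h) (i j)) G
      (gridMap x (cellValue M.1 i ω x h) o (rowsOf M.1 i) N)
      = G (cols i (walk M (mergeNoise x ω' ω) (N * h))) := by
  have hmat : glueRows x (fun r j => walkRow M.1 ω r (N * h) (i j))
      (gridMap x (cellValue M.1 i ω x h) o (rowsOf M.1 i) N)
      = (cols i (walk M (mergeNoise x ω' ω) (N * h))).1 := by
    funext r
    unfold glueRows
    split_ifs with hr
    · rw [← cellValue_mergeNoise i M ω' ω x h, ← walkRow_eq_gridMap M.1 i (h'.mergeNoise hω x) x hh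
        ((pathEvent_mergeNoise ω' ω).2 H) (by rwa [cellValue_mergeNoise]) le_rfl
        (Fin.lt_def.2 hr)]
      rfl
    · funext j
      exact (congrFun (walkRow_mergeNoise M.1 ω' ω (not_lt.1 hr) (N * h)) (i j)).symm
  unfold glueFun
  rw [dif_pos (by rw [hmat]; exact (cols i (walk M (mergeNoise x ω' ω) (N * h))).2)]
  congr 1
  exact Subtype.ext hmat

theorem extendOutcome_of_lt {x N : ℕ} (o : Fin N → Option (Fin x × ZMod 2)) {c : ℕ} (hc : c < N) :
    extendOutcome o c = o ⟨c, hc⟩ := dif_pos hc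

theorem integrable_walk_mergeNoise (ω : Noise n) (x : ℕ) {G : ColMat n i → ℝ} {B : ℝ}
    (hG : ∀ A, |G A| ≤ B) (t : ℝ) :
    Integrable (fun ω' => G (cols i (walk M (mergeNoise x ω' ω) t))) (noiseLaw n) := by
  have hm : Measurable fun ω' : Noise n => G (cols i (walk M (mergeNoise x ω' ω) t)) :=
    (measurable_comp_walk M fun A => G (cols i A)).comp
      (((measurable_mergeNoise x).comp (measurable_id.prodMk measurable_const)).prodMk
        measurable_const)
  exact Integrable.of_bound hm.aestronglyMeasurable B (ae_of_all _ fun ω' => hG _)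

/-- Comparison of the walk with the composition of the operators of the cells. -/
theorem abs_integral_mergeNoise_le_gridOp {ω : Noise n} (hω : Regular ω) (x : Fin n)
    {G : ColMat n i → ℝ} (hG : ∀ A, |G A| ≤ 2) {h : ℝ} (hh : 0 ≤ h) (N : ℕ) :
    |∫ ω', G (cols i (walk M (mergeNoise x ω' ω) (N * h))) ∂noiseLaw n|
      ≤ |gridOp x h (cellValue M.1 i ω x h) N
          (glueFun i x (fun r j => walkRow M.1 ω r (N * h) (i j)) G) (rowsOf M.1 i)|
        + 2 * (1 - ∑ o : Fin N → Option (Fin x × ZMod 2),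
          ∏ c : Fin N, cellWeight x h (cellValue M.1 i ω x h c) (o c)) := by
  classical
  set ρ := cellValue M.1 i ω x h with hρ
  set F := glueFun i x (fun r j => walkRow M.1 ω r (N * h) (i j)) G with hF
  -- The outcomes in which no row below x rings in a cell where row x does. On their disjoint events
  -- the walk is given exactly by `gridMap`; elsewhere |G| ≤ 2 costs twice the missing mass.
  set O : Finset (Fin N → Option (Fin x × ZMod 2)) :=
    Finset.univ.filter fun o => ∀ c : Fin N, ρ c = none → o c = none with hO
  set A : (Fin N → Option (Fin x × ZMod 2)) → Set (Noise n) :=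
    fun o => {ω' | PathEvent h N (extendOutcome o) ω'} with hA
  set val : (Fin N → Option (Fin x × ZMod 2)) → ℝ :=
    fun o => F (gridMap x ρ (extendOutcome o) (rowsOf M.1 i) N) with hval
  have hmA : ∀ o, MeasurableSet (A o) := fun o => measurableSet_pathEvent h N _
  have hweight : ∀ o ∈ O, (noiseLaw n).real (A o) = ∏ c : Fin N, cellWeight x h (ρ c) (o c) := by
    intro o ho
    have ho := (Finset.mem_filter.1 ho).2
    rw [hA, noiseLaw_pathEvent x.2.le hh N _ (0 : Fin k → ZMod 2), Finset.prod_range]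
    refine Finset.prod_congr rfl fun c _ => ?_
    rw [extendOutcome_of_lt o c.2]
    cases hρc : ρ c with
    | none => rw [ho c hρc]; rfl
    | some r => cases o c <;> rfl
  have hzero : ∀ o ∉ O, ∏ c : Fin N, cellWeight x h (ρ c) (o c) = 0 := by
    intro o ho
    rw [hO, Finset.mem_filter] at ho
    push Not at ho
    obtain ⟨c, hc, hoc⟩ := ho (Finset.mem_univ _)
    refine Finset.prod_eq_zero (Finset.mem_univ c) ?_
    rw [hc]
    obtain ⟨v, hv⟩ := Option.ne_none_iff_exists'.1 hoc
    rw [hv]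
    simp [cellWeight]
  have hsumO : ∀ φ : (Fin N → Option (Fin x × ZMod 2)) → ℝ,
      ∑ o, (∏ c : Fin N, cellWeight x h (ρ c) (o c)) * φ o
        = ∑ o ∈ O, (noiseLaw n).real (A o) * φ o := by
    intro φ
    rw [← Finset.sum_subset (Finset.subset_univ O)]
    · exact Finset.sum_congr rfl fun o ho => by rw [hweight o ho]
    · intro o _ ho
      rw [hzero o ho, zero_mul]
  have hmass := hsumO fun _ => 1
  simp only [mul_one] at hmass
  rw [hmass, gridOp_eq_sum, hsumO]
  set Φ : Noise n → ℝ := fun ω' => G (cols i (walk M (mergeNoise x ω' ω) (N * h))) with hΦ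
  have hΦi : Integrable Φ (noiseLaw n) := integrable_walk_mergeNoise M ω x hG _
  have hind : ∀ o (v : ℝ), Integrable ((A o).indicator fun _ => v) (noiseLaw n) := fun o v =>
    (integrable_const v).indicator (hmA o)
  have hSi : Integrable (fun ω' => ∑ o ∈ O, (A o).indicator (fun _ => val o) ω') (noiseLaw n) :=
    integrable_finsetSum _ fun o _ => hind o _
  have hSi1 : Integrable (fun ω' => ∑ o ∈ O, (A o).indicator (fun _ => (1 : ℝ)) ω')
      (noiseLaw n) := integrable_finsetSum _ fun o _ => hind o _
  have hSint : ∀ φ : (Fin N → Option (Fin x × ZMod 2)) → ℝ,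
      ∫ ω', ∑ o ∈ O, (A o).indicator (fun _ => φ o) ω' ∂noiseLaw n
        = ∑ o ∈ O, (noiseLaw n).real (A o) * φ o := by
    intro φ
    rw [integral_finsetSum _ fun o _ => hind o _]
    refine Finset.sum_congr rfl fun o _ => ?_
    rw [integral_indicator_const _ (hmA o), smul_eq_mul]
  have hae : ∀ᵐ ω' ∂noiseLaw n, ‖Φ ω' - ∑ o ∈ O, (A o).indicator (fun _ => val o) ω'‖
      ≤ 2 * (1 - ∑ o ∈ O, (A o).indicator (fun _ => (1 : ℝ)) ω') := by
    filter_upwards [ae_regular n] with ω' h'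
    by_cases hex : ∃ o ∈ O, ω' ∈ A o
    · obtain ⟨o, hoO, hoA⟩ := hex
      have huniq : ∀ o' ∈ O, o' ≠ o → ω' ∉ A o' := by
        intro o' _ hne ho'
        refine hne (funext fun c => ?_)
        have := PathEvent.unique x.2.le hh h'.1 ho' hoA c.2
        rwa [extendOutcome_of_lt o' c.2, extendOutcome_of_lt o c.2] at this
      have hs : ∀ φ : (Fin N → Option (Fin x × ZMod 2)) → ℝ,
          ∑ o ∈ O, (A o).indicator (fun _ => φ o) ω' = φ o := by
        intro φ
        rw [Finset.sum_eq_single_of_mem o hoO fun o' ho' hne =>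
          Set.indicator_of_notMem (huniq o' ho' hne) _, Set.indicator_of_mem hoA]
      have hv : val o = Φ ω' := by
        refine glueFun_gridMap M h' hω x hh hoA (fun c hc hn => ?_) G
        rw [extendOutcome_of_lt o hc]
        exact (Finset.mem_filter.1 hoO).2 ⟨c, hc⟩ hn
      rw [hs, hs fun _ => 1, hv]
      simp
    · push Not at hex
      have hs : ∀ φ : (Fin N → Option (Fin x × ZMod 2)) → ℝ,
          ∑ o ∈ O, (A o).indicator (fun _ => φ o) ω' = 0 := fun φ =>
        Finset.sum_eq_zero fun o ho => Set.indicator_of_notMem (hex o ho) _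
      rw [hs, hs fun _ => 1, sub_zero, sub_zero, mul_one]
      exact hG _
  have hle := norm_integral_le_of_norm_le (((integrable_const 1).sub hSi1).const_mul 2) hae
  rw [integral_sub hΦi hSi, hSint, integral_const_mul] at hle
  simp only [Pi.sub_apply] at hle
  rw [integral_sub (integrable_const 1) hSi1, hSint fun _ => 1] at hle
  simp only [integral_const, probReal_univ, smul_eq_mul, mul_one] at hle
  rw [Real.norm_eq_abs] at hle
  have htri := abs_sub_abs_le_abs_sub (∫ ω', Φ ω' ∂noiseLaw n)
    (∑ o ∈ O, (noiseLaw n).real (A o) * val o)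
  linarith

/-! ### Counting the cells -/

theorem card_cells_none_le {ω : Noise n} (hω : Regular ω) (x : Fin n) {h : ℝ} (hh : 0 ≤ h) (N : ℕ) :
    ((Finset.range N).filter fun c => (cellValue M.1 i ω x h c).isNone).card
      ≤ (hω.2 x (N * h)).toFinset.card := by
  classical
  have hex : ∀ c, (cellValue M.1 i ω x h c).isNone → ∃ j, InCell h c (ring ω x j) := by
    intro c hc
    unfold cellValue at hc
    split_ifs at hc with hj
    · exact hj
    · simp at hc
  refine Finset.card_le_card_of_injOn
    (fun c => if hc : (cellValue M.1 i ω x h c).isNone then (hex c hc).choose else 0) ?_ ?_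
  · intro c hc
    rw [Finset.mem_coe, Finset.mem_filter] at hc
    have hcN := Finset.mem_range.1 hc.1
    simp only [hc.2, dif_pos, Set.Finite.coe_toFinset, Set.mem_ofPred_eq]
    refine ((hex c hc.2).choose_spec.2).trans ?_
    refine mul_le_mul_of_nonneg_right ?_ hh
    exact_mod_cast hcN
  · intro c hc c' hc' heq
    rw [Finset.mem_coe, Finset.mem_filter] at hc hc'
    simp only [hc.2, hc'.2, dif_pos] at heq
    have h1 := (hex c hc.2).choose_spec
    have h2 := (hex c' hc'.2).choose_spec
    rw [← heq] at h2
    have key : ∀ {c c' : ℕ} {r : ℝ}, InCell h c r → InCell h c' r → ¬ c < c' := by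
      intro c c' r hr hr' hlt
      have : ((c : ℝ) + 1) * h ≤ c' * h := mul_le_mul_of_nonneg_right (by exact_mod_cast hlt) hh
      linarith [hr.2, hr'.1]
    have := key h1 h2
    have := key h2 h1
    omega

-- A cell where row x is quiet and does not start in the pattern contributes nothing. Every other
-- cell contributes at most h.
open Classical in
theorem integral_pattern_le {ω : Noise n} (x : Fin n) {h : ℝ} (hh : 0 ≤ h) (N : ℕ)
    {t₁ t₂ : ℝ} (ht₁ : 0 ≤ t₁) (ht : t₁ ≤ t₂) (ht₂ : t₂ ≤ N * h) :
    ∫ u in t₁..t₂, (if Pattern (cols i (walk M ω u)) x then (1 : ℝ) else 0)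
      ≤ (((Finset.range N).filter fun c => cellValue M.1 i ω x h c = some (patternRow k)).card
        + ((Finset.range N).filter fun c => (cellValue M.1 i ω x h c).isNone).card) * h := by
  set f : ℝ → ℝ := fun u => if Pattern (cols i (walk M ω u)) x then (1 : ℝ) else 0 with hf
  have hf0 : ∀ u, 0 ≤ f u := fun u => by simp only [hf]; positivity
  have hf1 : ∀ u, f u ≤ 1 := fun u => by simp only [hf]; split_ifs <;> simp
  have hfm : Measurable f :=
    (measurable_pattern i M x).comp (measurable_const.prodMk measurable_id)
  have hfi : ∀ a b, IntervalIntegrable f volume a b := by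
    intro a b
    refine (intervalIntegrable_const (c := (1 : ℝ))).mono_fun hfm.aestronglyMeasurable
      (ae_of_all _ fun u => ?_)
    simpa [abs_of_nonneg (hf0 u)] using hf1 u
  have hgrid : ∫ u in t₁..t₂, f u ≤ ∫ u in ((0 : ℕ) * h)..(N * h), f u := by
    refine intervalIntegral.integral_mono_interval (by simpa using ht₁) ht ht₂
      (ae_of_all _ hf0) (hfi _ _)
  rw [← intervalIntegral.sum_integral_adjacent_intervals
    (a := fun c : ℕ => (c : ℝ) * h) fun c _ => hfi _ _] at hgrid
  refine hgrid.trans ?_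
  have hcell : ∀ c : ℕ, ∫ u in (c * h)..((c + 1 : ℕ) * h), f u
      ≤ (if cellValue M.1 i ω x h c = some (patternRow k) then h else 0)
        + if (cellValue M.1 i ω x h c).isNone then h else 0 := by
    intro c
    have hle : (c : ℝ) * h ≤ ((c + 1 : ℕ) : ℝ) * h := by push_cast; nlinarith
    have h1 : ∫ u in (c * h)..((c + 1 : ℕ) * h), f u ≤ h := by
      have := intervalIntegral.integral_mono_on hle (hfi _ _)
        (intervalIntegrable_const (c := (1 : ℝ))) fun u _ => hf1 u
      refine this.trans (le_of_eq ?_)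
      rw [intervalIntegral.integral_const, smul_eq_mul]
      push_cast
      ring
    by_cases hn : ∃ j, InCell h c (ring ω x j)
    · have : cellValue M.1 i ω x h c = none := if_pos hn
      simpa [this] using h1
    · have hv : cellValue M.1 i ω x h c = some fun j => walkRow M.1 ω x (c * h) (i j) := if_neg hn
      by_cases hp : (fun j => walkRow M.1 ω x (c * h) (i j)) = patternRow k
      · rw [hv, hp]
        simpa using h1
      · have hz : ∀ u ∈ Set.uIcc (c * h) (((c + 1 : ℕ) : ℝ) * h), f u = 0 := by
          intro u hu
          rw [Set.uIcc_of_le hle] at hu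
          refine if_neg fun hpat => hp (funext fun j => ?_)
          have hno : walkRow M.1 ω x u = walkRow M.1 ω x (c * h) := by
            refine walkRow_eq_of_no_ring M.1 hu.1 fun j hj => hn ⟨j, hj.1, hj.2.trans ?_⟩
            have := hu.2
            push_cast at this
            exact this
          rw [← hno]
          exact hpat j
        rw [intervalIntegral.integral_congr (g := fun _ => 0) hz]
        simp [hv, hp]
  refine (Finset.sum_le_sum fun c _ => hcell c).trans (le_of_eq ?_)
  rw [Finset.sum_add_distrib, ← Finset.sum_filter, ← Finset.sum_filter, Finset.sum_const,
    Finset.sum_const, nsmul_eq_mul, nsmul_eq_mul]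
  ring

end Merge

end MatrixWalk
-- The limit of fine grids
namespace MatrixWalk

open Classical in
/-- Given the noise of the rows from `x` on, for which row `x` is good, the conditional expectation
of an observable with vanishing average over the last column in the rows below `x` is small. -/
theorem abs_integral_mergeNoise_le {n k : ℕ} (hk : 1 ≤ k) {i : Fin k → Fin n} (M : UniMat n)
    {ω : Noise n} (hω : Regular ω) {x : Fin n} {t₁ t₂ t : ℝ} (ht₁ : 0 ≤ t₁) (h12 : t₁ < t₂)
    (ht₂ : t₂ ≤ t) (hgood : GoodRow (fun u => cols i (walk M ω u)) t₁ t₂ x) {b : ℕ} (hb : b ≤ x)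
    {G : ColMat n i → ℝ} (hG2 : ∀ A, |G A| ≤ 2)
    (hGb : ∀ A B, AgreeOff (lastColUpTo n k b) A B → G A = G B)
    (hG0 : ∀ A, ∑ B with AgreeOff (lastColUpTo n k x) A B, G B = 0) :
    |∫ ω', G (cols i (walk M (mergeNoise x ω' ω) t)) ∂noiseLaw n|
      ≤ 2 * 2 ^ (x.val - b) * Real.exp (-((t₂ - t₁) / 2 ^ (k + 1) / 268)) := by
  set T := (t₂ - t₁) / 2 ^ (k + 1) with hT
  have hT0 : 0 < T := div_pos (by linarith) (by positivity)
  have hgood' : T ≤ ∫ u in t₁..t₂, (if Pattern (cols i (walk M ω u)) x then (1 : ℝ) else 0) := by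
    convert! hgood
  have ht0 : 0 ≤ t := by linarith
  -- Strictly beneath row i_k the last column is identically 0, so such a row never shows the
  -- pattern and cannot be good.
  have hxi : ∀ j : Fin k, j.val + 1 = k → x.val ≤ (i j).val := by
    intro j hj
    by_contra hlt
    have hnp : ∀ u, ¬ Pattern (cols i (walk M ω u)) x := by
      intro u hpat
      have h1 := hpat j
      rw [if_pos hj, ((cols i (walk M ω u)).2 j).1 x (Fin.lt_def.2 (not_le.1 hlt))] at h1
      exact absurd h1 (by decide)
    simp only [hnp, if_false, intervalIntegral.integral_zero] at hgood'
    linarith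
  set m : ℝ := ((hω.2 x t).toFinset.card : ℝ) with hm
  set X : ℝ := ((x.val : ℕ) : ℝ) with hX
  have hX0 : 0 ≤ X := Nat.cast_nonneg _
  -- For N + 1 cells of length t e, with e = 1 / (N + 1), this collects the contraction and the
  -- missing mass. For fixed frozen noise the number m of rings of row x up to t does not depend on
  -- N, so all corrections are linear in e and only the value at 0 survives.
  set φ : ℝ → ℝ := fun e => 2 * 2 ^ (x.val - b)
    * Real.exp ((X * t) ^ 2 * e + m * t / 268 * e - T / 268)
    + 2 * ((X * t) ^ 2 * e + m * (X * t) * e) with hφ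
  have hbound : ∀ N : ℕ, |∫ ω', G (cols i (walk M (mergeNoise x ω' ω) t)) ∂noiseLaw n|
      ≤ φ (1 / ((N : ℝ) + 1)) := by
    intro N
    set e : ℝ := 1 / ((N : ℝ) + 1) with he
    have he0 : 0 < e := by positivity
    have hh : 0 ≤ t * e := by positivity
    have hNe : ((N + 1 : ℕ) : ℝ) * e = 1 := by rw [he]; push_cast; field_simp
    have hNt : ((N + 1 : ℕ) : ℝ) * (t * e) = t := by rw [mul_left_comm, hNe, mul_one]
    have h1 := abs_integral_mergeNoise_le_gridOp M hω x hG2 hh (N + 1)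
    have h2 := abs_gridOp_glueFun_le hk x.2.le hb hxi
      (fun r j => walkRow M.1 ω r (((N + 1 : ℕ) : ℝ) * (t * e)) (i j)) hG2 hGb hG0 hh
      (cellValue M.1 i ω x (t * e)) (N + 1) (rowsOf M.1 i)
    have h3 := one_sub_le_sum_prod_cellWeight x (N + 1) hh (cellValue M.1 i ω x (t * e))
    have h4 := card_cells_none_le (i := i) M hω x hh (N + 1)
    have h5 := integral_pattern_le (i := i) M (ω := ω) x hh (N + 1) ht₁ h12.le
      (by rw [hNt]; exact ht₂)
    rw [hNt] at h1 h2 h4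
    have h4' : (((Finset.range (N + 1)).filter
        fun c => (cellValue M.1 i ω x (t * e) c).isNone).card : ℝ) ≤ m := by
      rw [hm]; exact_mod_cast h4
    set z : ℝ := (((Finset.range (N + 1)).filter
        fun c => (cellValue M.1 i ω x (t * e) c).isNone).card : ℝ) with hz
    have h5' := hgood'.trans h5
    have hsq : ((N + 1 : ℕ) : ℝ) * (X * (t * e)) ^ 2 = (X * t) ^ 2 * e := by
      have : ((N + 1 : ℕ) : ℝ) * (X * (t * e)) ^ 2 = (((N + 1 : ℕ) : ℝ) * e) * ((X * t) ^ 2 * e) := by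
        ring
      rw [this, hNe, one_mul]
    rw [hsq] at h2 h3
    have hzm : z * (t * e) ≤ m * (t * e) := mul_le_mul_of_nonneg_right h4' hh
    have hzX : z * (X * (t * e)) ≤ m * (X * (t * e)) :=
      mul_le_mul_of_nonneg_right h4' (by positivity)
    have hexp : (2 : ℝ) * 2 ^ (x.val - b) * Real.exp ((X * t) ^ 2 * e
        - (((Finset.range (N + 1)).filter
          fun c => cellValue M.1 i ω x (t * e) c = some (patternRow k)).card : ℝ) * (t * e) / 268)
        ≤ 2 * 2 ^ (x.val - b) * Real.exp ((X * t) ^ 2 * e + m * t / 268 * e - T / 268) := by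
      refine mul_le_mul_of_nonneg_left (Real.exp_le_exp.2 ?_) (by positivity)
      linarith
    have h2' := h2.trans hexp
    simp only [hφ]
    linarith
  have hlim : Filter.Tendsto (fun N : ℕ => φ (1 / ((N : ℝ) + 1))) Filter.atTop (nhds (φ 0)) := by
    have hc : Continuous φ := by simp only [hφ]; fun_prop
    exact (hc.tendsto 0).comp tendsto_one_div_add_atTop_nhds_zero_nat
  have h := ge_of_tendsto' hlim hbound
  simpa [hφ] using h

/-! ### Averages -/

section Averages

variable {n k : ℕ} {i : Fin k → Fin n} {S S' : Set (Fin n × Fin k)} {A B C : ColMat n i}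

theorem AgreeOff.refl (S : Set (Fin n × Fin k)) (A : ColMat n i) : AgreeOff S A A :=
  fun _ _ _ => rfl

theorem AgreeOff.symm (h : AgreeOff S A B) : AgreeOff S B A := fun r j hrj => (h r j hrj).symm

theorem AgreeOff.trans (h : AgreeOff S A B) (h' : AgreeOff S B C) : AgreeOff S A C :=
  fun r j hrj => (h r j hrj).trans (h' r j hrj)

theorem AgreeOff.mono (hS : S ⊆ S') (h : AgreeOff S A B) : AgreeOff S' A B :=
  fun r j hrj => h r j fun hm => hrj (hS hm)

theorem avg_congr (g : ColMat n i → ℝ) (h : AgreeOff S A B) : avg S g A = avg S g B := by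
  classical
  have : ∀ C, AgreeOff S A C ↔ AgreeOff S B C := fun C => ⟨h.symm.trans, h.trans⟩
  simp only [avg, this]

theorem abs_avg_le {g : ColMat n i → ℝ} (hg : ∀ A, |g A| ≤ 1) (A : ColMat n i) :
    |avg S g A| ≤ 1 := by
  classical
  unfold avg
  rw [abs_div, Nat.abs_cast]
  refine div_le_one_of_le₀ ((Finset.abs_sum_le_sum_abs _ _).trans ?_) (Nat.cast_nonneg _)
  refine (Finset.sum_le_card_nsmul _ _ 1 fun B _ => hg B).trans (le_of_eq ?_)
  simp

-- Double counting: each C of the large class lies in exactly as many small classes of points B as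
-- its own small class has elements, which cancels the normalisation.
open Classical in
theorem sum_sub_avg_eq_zero (hS : S ⊆ S') (g : ColMat n i → ℝ) (A : ColMat n i) :
    ∑ B with AgreeOff S' A B, (g B - avg S g B) = 0 := by
  set P := Finset.univ.filter fun B => AgreeOff S' A B with hP
  have h1 : ∑ B ∈ P, avg S g B = ∑ B ∈ P, ∑ C ∈ P, if AgreeOff S B C then
      g C / (Finset.univ.filter fun D => AgreeOff S C D).card else 0 := by
    refine Finset.sum_congr rfl fun B hB => ?_
    have hB := (Finset.mem_filter.1 hB).2
    have hsub : (Finset.univ.filter fun C => AgreeOff S B C) = P.filter fun C => AgreeOff S B C := by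
      ext C
      simp only [hP, Finset.mem_filter, Finset.mem_univ, true_and]
      exact ⟨fun h => ⟨hB.trans (h.mono hS), h⟩, fun h => h.2⟩
    rw [← Finset.sum_filter, ← hsub, avg, Finset.sum_div]
    refine Finset.sum_congr rfl fun C hC => ?_
    have hC := (Finset.mem_filter.1 hC).2
    have : ∀ D, AgreeOff S B D ↔ AgreeOff S C D := fun D => ⟨hC.symm.trans, hC.trans⟩
    simp only [this]
  have h2 : ∑ B ∈ P, avg S g B = ∑ C ∈ P, g C := by
    rw [h1, Finset.sum_comm]
    refine Finset.sum_congr rfl fun C hC => ?_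
    have hC := (Finset.mem_filter.1 hC).2
    have hsub : (P.filter fun B => AgreeOff S B C) = Finset.univ.filter fun D => AgreeOff S C D := by
      ext B
      simp only [hP, Finset.mem_filter, Finset.mem_univ, true_and]
      exact ⟨fun h => h.2.symm, fun h => ⟨hC.trans (h.mono hS), h.symm⟩⟩
    rw [← Finset.sum_filter, hsub, Finset.sum_const, nsmul_eq_mul, mul_div_cancel₀]
    exact Nat.cast_ne_zero.2 (Finset.card_pos.2
      ⟨C, Finset.mem_filter.2 ⟨Finset.mem_univ _, AgreeOff.refl S C⟩⟩).ne'
  rw [Finset.sum_sub_distrib, h2, sub_self]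

end Averages

theorem lastColUpTo_mono {n k b b' : ℕ} (h : b ≤ b') : lastColUpTo n k b ⊆ lastColUpTo n k b' :=
  fun _ hp => ⟨hp.1.trans h, hp.2⟩

/-! ### Decomposition according to the lowest good row -/

section Decomposition

variable {n k : ℕ} (i : Fin k → Fin n) (M : UniMat n)

/-- Row `x` is good, and no row between `x` and the row number `q` is good. -/
def lastGood (q : ℕ) (s t : ℝ) (x : Fin n) : Set (Noise n) :=
  {ω | GoodRow (fun u => cols i (walk M ω u)) s t x ∧ ∀ y, x < y → y.val + 1 ≤ q →
    ¬ GoodRow (fun u => cols i (walk M ω u)) s t y}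

theorem measurableSet_lastGood (q : ℕ) (s t : ℝ) (x : Fin n) :
    MeasurableSet (lastGood i M q s t x) := by
  have : lastGood i M q s t x = {ω | GoodRow (fun u => cols i (walk M ω u)) s t x}
      ∩ ⋂ y, ⋂ (_ : x < y), ⋂ (_ : y.val + 1 ≤ q),
        {ω | GoodRow (fun u => cols i (walk M ω u)) s t y}ᶜ := by
    ext ω
    simp [lastGood]
  rw [this]
  refine (measurableSet_goodRow i M s t x).inter ?_
  exact MeasurableSet.iInter fun y => MeasurableSet.iInter fun _ => MeasurableSet.iInter fun _ =>
    (measurableSet_goodRow i M s t y).compl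

theorem goodRow_mergeNoise {x : ℕ} (ω' ω : Noise n) {y : Fin n} (hy : x ≤ y.val) (s t : ℝ) :
    GoodRow (fun u => cols i (walk M (mergeNoise x ω' ω) u)) s t y
      ↔ GoodRow (fun u => cols i (walk M ω u)) s t y := by
  have h : ∀ u, Pattern (cols i (walk M (mergeNoise x ω' ω) u)) y
      ↔ Pattern (cols i (walk M ω u)) y := by
    intro u
    have := walkRow_mergeNoise M.1 ω' ω hy u
    refine forall_congr' fun j => ?_
    change walkRow M.1 (mergeNoise x ω' ω) y u (i j) = _ ↔ walkRow M.1 ω y u (i j) = _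
    rw [this]
  classical
  unfold GoodRow
  have h2 : ∀ u, (if Pattern (cols i (walk M (mergeNoise x ω' ω) u)) y then (1 : ℝ) else 0)
      = if Pattern (cols i (walk M ω u)) y then 1 else 0 := fun u => if_congr (h u) rfl rfl
  convert! Iff.rfl using 3
  funext u
  convert! (h2 u).symm

/-- Choosing the good row of largest index makes the event depend only on rows from x on, so
resampling the rows below x leaves it unchanged. -/
theorem mem_lastGood_mergeNoise (ω' ω : Noise n) (q : ℕ) (s t : ℝ) (x : Fin n) :
    mergeNoise x ω' ω ∈ lastGood i M q s t x ↔ ω ∈ lastGood i M q s t x := by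
  unfold lastGood
  simp only [Set.mem_ofPred_eq]
  rw [goodRow_mergeNoise i M ω' ω le_rfl]
  refine and_congr_right fun _ => forall_congr' fun y => forall_congr' fun hy => ?_
  rw [goodRow_mergeNoise i M ω' ω (Fin.le_def.1 hy.le)]

theorem goodEvent_eq_biUnion (p q : ℕ) (s t : ℝ) :
    goodEvent i M p q s t = ⋃ x ∈ Finset.univ.filter fun x : Fin n => p ≤ x.val + 1 ∧ x.val + 1 ≤ q,
      lastGood i M q s t x := by
  classical
  ext ω
  simp only [goodEvent, Set.mem_ofPred_eq, Set.mem_iUnion, Finset.mem_filter, Finset.mem_univ,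
    true_and, exists_prop]
  constructor
  · rintro ⟨r, hpr, hrq, hr⟩
    set W := Finset.univ.filter fun x : Fin n =>
      (p ≤ x.val + 1 ∧ x.val + 1 ≤ q) ∧ GoodRow (fun u => cols i (walk M ω u)) s t x with hW
    have hne : W.Nonempty := ⟨r, Finset.mem_filter.2 ⟨Finset.mem_univ _, ⟨hpr, hrq⟩, hr⟩⟩
    have hmax := (Finset.mem_filter.1 (Finset.max'_mem W hne)).2
    refine ⟨W.max' hne, hmax.1, hmax.2, fun y hy hyq hgood => ?_⟩
    have : y ∈ W := by
      refine Finset.mem_filter.2 ⟨Finset.mem_univ _, ⟨?_, hyq⟩, hgood⟩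
      have := Fin.lt_def.1 hy
      omega
    exact absurd hy (not_lt.2 (Finset.le_max' W y this))
  · rintro ⟨x, hx, hgood, -⟩
    exact ⟨x, hx.1, hx.2, hgood⟩

theorem disjoint_lastGood {q : ℕ} {s t : ℝ} {x y : Fin n} (hxy : x < y) (hy : y.val + 1 ≤ q) :
    Disjoint (lastGood i M q s t x) (lastGood i M q s t y) :=
  Set.disjoint_left.2 fun _ hx hy' => hx.2 y hxy hy hy'.1

variable {i}

theorem integrable_walk {G : ColMat n i → ℝ} {B : ℝ} (hG : ∀ A, |G A| ≤ B) (t : ℝ) :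
    Integrable (fun ω => G (cols i (walk M ω t))) (noiseLaw n) := by
  have hm : Measurable fun ω : Noise n => G (cols i (walk M ω t)) :=
    (measurable_comp_walk M fun A => G (cols i A)).comp (measurable_id.prodMk measurable_const)
  exact Integrable.of_bound hm.aestronglyMeasurable B (ae_of_all _ fun ω => hG _)

open Classical in
theorem abs_setIntegral_lastGood_le (hk : 1 ≤ k) (q : ℕ) {x : Fin n} {t₁ t₂ t : ℝ} (ht₁ : 0 ≤ t₁)
    (h12 : t₁ < t₂) (ht₂ : t₂ ≤ t) {b : ℕ} (hb : b ≤ x) {G : ColMat n i → ℝ}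
    (hG2 : ∀ A, |G A| ≤ 2) (hGb : ∀ A B, AgreeOff (lastColUpTo n k b) A B → G A = G B)
    (hG0 : ∀ A, ∑ B with AgreeOff (lastColUpTo n k x) A B, G B = 0) :
    |∫ ω in lastGood i M q t₁ t₂ x, G (cols i (walk M ω t)) ∂noiseLaw n|
      ≤ 2 * 2 ^ (x.val - b) * Real.exp (-((t₂ - t₁) / 2 ^ (k + 1) / 268))
        * (noiseLaw n).real (lastGood i M q t₁ t₂ x) := by
  set E := lastGood i M q t₁ t₂ x with hE
  set ε := 2 * 2 ^ (x.val - b) * Real.exp (-((t₂ - t₁) / 2 ^ (k + 1) / 268)) with hε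
  have hmE : MeasurableSet E := measurableSet_lastGood i M q t₁ t₂ x
  set f : Noise n → ℝ := E.indicator fun ω => G (cols i (walk M ω t)) with hf
  have hfi : Integrable f (noiseLaw n) := (integrable_walk M hG2 t).indicator hmE
  have hmp := measurePreserving_mergeNoise (n := n) x
  have hfi' : Integrable (fun p : Noise n × Noise n => f (mergeNoise x p.1 p.2))
      ((noiseLaw n).prod (noiseLaw n)) := hmp.integrable_comp_of_integrable hfi
  -- Resampling the rows below x preserves the law of the noise; Fubini turns this into conditioning
  -- on the rows from x on.
  have h1 : ∫ ω, f ω ∂noiseLaw n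
      = ∫ ω, ∫ ω', f (mergeNoise x ω' ω) ∂noiseLaw n ∂noiseLaw n := by
    rw [← integral_prod_symm _ hfi']
    conv_lhs => rw [← map_mergeNoise x]
    rw [integral_map (measurable_mergeNoise x).aemeasurable]
    rw [map_mergeNoise]
    exact hfi.aestronglyMeasurable
  rw [← integral_indicator hmE, ← hf, h1, ← Real.norm_eq_abs]
  have hb : ∀ᵐ ω ∂noiseLaw n, ‖∫ ω', f (mergeNoise x ω' ω) ∂noiseLaw n‖
      ≤ E.indicator (fun _ => ε) ω := by
    filter_upwards [ae_regular n] with ω hω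
    have hmem : ∀ ω', mergeNoise x ω' ω ∈ E ↔ ω ∈ E := fun ω' =>
      mem_lastGood_mergeNoise i M ω' ω q t₁ t₂ x
    by_cases hωE : ω ∈ E
    · rw [Set.indicator_of_mem hωE]
      have : ∀ ω', f (mergeNoise x ω' ω) = G (cols i (walk M (mergeNoise x ω' ω) t)) := fun ω' =>
        Set.indicator_of_mem ((hmem ω').2 hωE) _
      simp only [this]
      exact abs_integral_mergeNoise_le hk M hω ht₁ h12 ht₂ hωE.1 hb hG2 hGb hG0
    · rw [Set.indicator_of_notMem hωE]
      have : ∀ ω', f (mergeNoise x ω' ω) = 0 := fun ω' =>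
        Set.indicator_of_notMem (fun h => hωE ((hmem ω').1 h)) _
      simp [this]
  refine (norm_integral_le_of_norm_le ((integrable_const ε).indicator hmE) hb).trans (le_of_eq ?_)
  rw [integral_indicator_const _ hmE, smul_eq_mul, mul_comm]

/-- Row number b + 1 has index b, and the rows below it are the rows number 1, …, b. So the smallest
admissible good row is exactly the one for which averaging over b rows removes the coefficient of ∅.
-/
theorem abs_integral_sub_avg_le (hk : 1 ≤ k) {a b Δ : ℕ} (hab : a ≤ b + 1) {t₁ t₂ t : ℝ}
    (ht₁ : 0 ≤ t₁) (h12 : t₁ < t₂) (ht₂ : t₂ ≤ t)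
    (hlen : 1000 * (Δ : ℝ) ≤ (t₂ - t₁) / 2 ^ (k + 1)) {g : ColMat n i → ℝ}
    (hg : ∀ A, |g A| ≤ 1)
    (hga : ∀ A B, AgreeOff (lastColUpTo n k (a - 1)) A B → g A = g B) :
    |∫ ω, (g (cols i (walk M ω t)) - avg (lastColUpTo n k b) g (cols i (walk M ω t)))
        ∂noiseLaw n|
      ≤ 2 * (Real.exp (-1 * Δ)
        + (noiseLaw n).real (goodEvent i M (b + 1) (a + 2 * Δ) t₁ t₂)ᶜ) := by
  classical
  set G : ColMat n i → ℝ := fun A => g A - avg (lastColUpTo n k b) g A with hG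
  have hG2 : ∀ A, |G A| ≤ 2 := by
    intro A
    refine (abs_sub _ _).trans ?_
    linarith [hg A, abs_avg_le (S := lastColUpTo n k b) hg A]
  have hGa : ∀ A B, AgreeOff (lastColUpTo n k (a - 1)) A B → G A = G B := by
    intro A B h
    simp only [hG]
    rw [hga A B h, avg_congr g (h.mono (lastColUpTo_mono (by omega)))]
  set W := Finset.univ.filter fun x : Fin n => b + 1 ≤ x.val + 1 ∧ x.val + 1 ≤ a + 2 * Δ with hW
  set E := lastGood i M (a + 2 * Δ) t₁ t₂ with hE
  have hmE : ∀ x, MeasurableSet (E x) := fun x => measurableSet_lastGood i M _ t₁ t₂ x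
  have hgoodE : goodEvent i M (b + 1) (a + 2 * Δ) t₁ t₂ = ⋃ x ∈ W, E x :=
    goodEvent_eq_biUnion i M _ _ t₁ t₂
  have hdisj : (W : Set (Fin n)).Pairwise fun x y => Disjoint (E x) (E y) := by
    intro x hx y hy hne
    rcases lt_or_gt_of_ne hne with h | h
    · exact disjoint_lastGood i M h (Finset.mem_filter.1 hy).2.2
    · exact (disjoint_lastGood i M h (Finset.mem_filter.1 hx).2.2).symm
  have hmgood : MeasurableSet (goodEvent i M (b + 1) (a + 2 * Δ) t₁ t₂) := by
    rw [hgoodE]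
    exact Finset.measurableSet_biUnion _ fun x _ => hmE x
  have hint := integrable_walk M hG2 t
  change |∫ ω, G (cols i (walk M ω t)) ∂noiseLaw n| ≤ _
  rw [← integral_add_compl hmgood hint]
  refine (abs_add_le _ _).trans ?_
  rw [mul_add]
  refine add_le_add ?_ ?_
  · have hεx : ∀ x ∈ W, |∫ ω in E x, G (cols i (walk M ω t)) ∂noiseLaw n|
        ≤ 2 * Real.exp (-1 * Δ) * (noiseLaw n).real (E x) := by
      intro x hx
      have hx := (Finset.mem_filter.1 hx).2
      refine (abs_setIntegral_lastGood_le M hk (a + 2 * Δ) ht₁ h12 ht₂ (b := a - 1) (by omega) hG2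
        hGa (fun A => ?_)).trans ?_
      · convert! sum_sub_avg_eq_zero (S := lastColUpTo n k b) (S' := lastColUpTo n k x.val)
          (lastColUpTo_mono (by omega)) g A
      · refine mul_le_mul_of_nonneg_right ?_ measureReal_nonneg
        rw [mul_assoc]
        refine mul_le_mul_of_nonneg_left ?_ (by norm_num)
        -- The relevant indices run from a - 1 to x - 1, at most 2Δ of them, also when a = 0 and a -
        -- 1 truncates. Since 2 - 1000 / 268 ≤ -1, the total exponent is at most -Δ.
        have hpow : (2 : ℝ) ^ (x.val - (a - 1)) ≤ Real.exp (2 * Δ) := by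
          calc (2 : ℝ) ^ (x.val - (a - 1)) ≤ 2 ^ (2 * Δ) :=
                pow_le_pow_right₀ (by norm_num) (by omega)
            _ ≤ Real.exp 1 ^ (2 * Δ) :=
                pow_le_pow_left₀ (by norm_num) (by linarith [Real.add_one_le_exp (1 : ℝ)]) _
            _ = Real.exp (2 * Δ) := by
                rw [← Real.exp_nat_mul]; push_cast; ring_nf
        refine (mul_le_mul_of_nonneg_right hpow (Real.exp_pos _).le).trans ?_
        rw [← Real.exp_add]
        refine Real.exp_le_exp.2 ?_
        have : (0 : ℝ) ≤ Δ := Nat.cast_nonneg _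
        linarith
    rw [hgoodE, integral_biUnion_finset _ (fun x _ => hmE x) hdisj fun x _ => hint.integrableOn]
    refine (Finset.abs_sum_le_sum_abs _ _).trans ((Finset.sum_le_sum hεx).trans ?_)
    rw [← Finset.mul_sum, ← measureReal_biUnion_finset hdisj fun x _ => hmE x]
    exact mul_le_of_le_one_right (by positivity) measureReal_le_one
  · have := norm_setIntegral_le_of_norm_le_const (μ := noiseLaw n)
      (s := (goodEvent i M (b + 1) (a + 2 * Δ) t₁ t₂)ᶜ) (C := 2) (measure_lt_top _ _)
      (f := fun ω => G (cols i (walk M ω t))) fun ω _ => hG2 _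
    exact this

end Decomposition

end MatrixWalk

/-! ### The theorem -/

theorem mainTheorem4 :
    ∃ c : ℝ, 0 < c ∧ ∃ κ : ℕ → ℝ, (∀ k, 0 < κ k) ∧ (∃ K : ℝ, ∀ k, κ k ≤ K * 2 ^ k) ∧
      ∀ (k : ℕ), 1 ≤ k → ∀ (n : ℕ) (i : Fin k → Fin n), StrictMono i →
      ∀ (a Δ : ℕ), 1 ≤ Δ → a + 2 * Δ ≤ n →
      ∀ (t₁ t₂ t : ℝ), 0 < t₁ → t₂ = t₁ + κ k * Δ → t₂ < t →
      ∀ (g : MatrixWalk.ColMat n i → ℝ), (∀ A, |g A| ≤ 1) →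
      (∀ A B, MatrixWalk.AgreeOff (MatrixWalk.lastColUpTo n k (a - 1)) A B → g A = g B) →
      ∀ (M : MatrixWalk.UniMat n),
        |∫ ω, (g (MatrixWalk.cols i (MatrixWalk.walk M ω t))
            - MatrixWalk.avg (MatrixWalk.lastColUpTo n k (a + Δ)) g
                (MatrixWalk.cols i (MatrixWalk.walk M ω t))) ∂(MatrixWalk.noiseLaw n)|
          ≤ 2 * (Real.exp (-c * Δ) + (MatrixWalk.noiseLaw n).real
              (MatrixWalk.goodEvent i M (a + Δ + 1) (a + 2 * Δ) t₁ t₂)ᶜ) ∧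
        |∫ ω, (g (MatrixWalk.cols i (MatrixWalk.walk M ω t))
            - MatrixWalk.avg (MatrixWalk.lastColUpTo n k (a + Δ - 1)) g
                (MatrixWalk.cols i (MatrixWalk.walk M ω t))) ∂(MatrixWalk.noiseLaw n)|
          ≤ 2 * (Real.exp (-c * Δ) + (MatrixWalk.noiseLaw n).real
              (MatrixWalk.goodEvent i M (a + Δ) (a + 2 * Δ) t₁ t₂)ᶜ) := by
  -- With κ(k) = 2000 · 2 ^ k, a good row shows the pattern for time at least κ(k) Δ / 2 ^ (k + 1) =
  -- 1000 Δ.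
  refine ⟨1, one_pos, fun k => 2000 * 2 ^ k, fun k => by positivity, ⟨2000, fun k => le_rfl⟩, ?_⟩
  intro k hk n i _ a Δ hΔ _ t₁ t₂ t ht₁ ht₂ ht g hg hga M
  have hΔ0 : (0 : ℝ) < Δ := by exact_mod_cast hΔ
  have h12 : t₁ < t₂ := by
    rw [ht₂]
    have : (0 : ℝ) < 2000 * 2 ^ k * Δ := by positivity
    linarith
  have hlen : 1000 * (Δ : ℝ) ≤ (t₂ - t₁) / 2 ^ (k + 1) := by
    rw [ht₂, le_div_iff₀ (by positivity), pow_succ]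
    apply le_of_eq
    ring
  refine ⟨MatrixWalk.abs_integral_sub_avg_le M hk (by omega) ht₁.le h12 ht.le hlen hg hga, ?_⟩
  -- Averaging over one row fewer admits row number a + Δ as a good row; Δ ≥ 1 keeps the subtraction
  -- from truncating.
  have h := MatrixWalk.abs_integral_sub_avg_le M hk (a := a) (b := a + Δ - 1) (by omega) ht₁.le h12
    ht.le hlen hg hga
  rwa [show a + Δ - 1 + 1 = a + Δ by omega] at h
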